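/- Let $k$ be a perfect field. A Severi–Brauer surface over $k$ is a smooth projective $k$-scheme $S$ with $S_{\bar k}\simeq\mathbb P^2_{\bar k}$; it is non-trivial if $S\not\simeq\mathbb P^2_k$. Let $S$ be a Severi–Brauer surface, $L/k$ a finite Galois extension and $\varphi:S_L\to\mathbb P^2_L$ an $L$-isomorphism. For $g\in\mathrm{Gal}(L/k)$ choose $A_g\in\mathrm{GL}_3(L)$ with $\varphi\circ g\circ\varphi^{-1}=[A_g]\circ g$, where $[A_g]$ denotes the induced automorphism of $\mathbb P^2_L$. For $\alpha\in\mathrm{Aut}_k(S)$, an affine representant of $\alpha$ is a matrix $A\in\mathrm{GL}_3(L)$ with $\varphi\circ\alpha\circ\varphi^{-1}=[A]$ and $A^g=A_g^{-1}AA_g$ for all $g\in\mathrm{Gal}(L/k)$, where $A^g$ is obtained by applying $g$ to the entries of $A$. Then $\det(A)\in k^*$, and $\det(\alpha)\in k^*/(k^*)^3$ is defined to be the class of $\det(A)$ (it depends only on $\alpha$). We say that $S$ corresponds to a central simple $k$-algebra $D$ of dimension $9$ if, for some finite Galois extension $L/k$, there are $\varphi$ and $A_g$ as above and an isomorphism of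 $L$-algebras $f:L\otimes_kD\to M_3(L)$ with $f(g(x))=A_g\,f(x)^g\,A_g^{-1}$ for all $x\in L\otimes_k D$ and $g\in\mathrm{Gal}(L/k)$, where $g$ acts on $L\otimes_kD$ through the first factor. The opposite surface $S^{op}$ is the Severi–Brauer surface (unique up to isomorphism) that corresponds to the opposite algebra $D^{op}$ of an algebra $D$ to which $S$ corresponds. **Lemma.** Let $S$ be a non-trivial Severi–Brauer surface over $k$. Then $$\det(\mathrm{Aut}_k(S))=\det(\mathrm{Aut}_k(S^{op}))\quad\text{as subsets of } k^*/(k^*)^3 .$$ -/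

import Mathlib

open CategoryTheory CategoryTheory.Limits AlgebraicGeometry MvPolynomial TensorProduct

universe u

noncomputable section

namespace SeveriBrauer

/-! ### Projective space, its linear automorphisms and the Galois action on it -/

/-- The standard grading of `K[x₀, …, xₙ]`. -/
abbrev coordGrading (n : ℕ) (K : Type u) [Field K] :
    ℕ → Submodule K (MvPolynomial (Fin (n + 1)) K) :=
  homogeneousSubmodule (Fin (n + 1)) K

instance coordGradedAlgebra (n : ℕ) (K : Type u) [Field K] :
    GradedAlgebra (coordGrading n K) :=
  MvPolynomial.gradedAlgebra

/-- Projective `n`-space over `K`, as a scheme over `Spec K`. -/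
def projSpace (n : ℕ) (K : Type u) [Field K] : Over (Spec (CommRingCat.of K)) :=
  Over.mk (Proj.toSpecZero (coordGrading n K) ≫
    Spec.map (CommRingCat.ofHom (algebraMap K (coordGrading n K 0))))

/-- The graded `K`-algebra endomorphism of `K[x₀, …, xₙ]` with `xᵢ ↦ ∑ⱼ Mᵢⱼ xⱼ`. -/
def linearHom {n : ℕ} {K : Type u} [Field K] (M : Matrix (Fin (n + 1)) (Fin (n + 1)) K) :
    GradedRingHom (coordGrading n K) (coordGrading n K) where
  toRingHom := (aeval (fun i => ∑ j, C (M i j) * X j) :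
    MvPolynomial (Fin (n + 1)) K →ₐ[K] MvPolynomial (Fin (n + 1)) K)
  map_mem := by
    intro i p hp
    have h := IsHomogeneous.aeval (R := K) (n := 1) ((mem_homogeneousSubmodule i p).1 hp)
      (fun i => ∑ j, C (M i j) * X j)
      (fun i => IsHomogeneous.sum _ _ _ fun j _ => by
        simpa using (isHomogeneous_C (Fin (n + 1)) (M i j)).mul (isHomogeneous_X K j))
    rw [one_mul] at h
    exact h

/-- The graded ring endomorphism of `K[x₀, …, xₙ]` that applies `τ` to the coefficients. -/
def coeffHom (n : ℕ) {K : Type u} [Field K] (τ : K →+* K) :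
    GradedRingHom (coordGrading n K) (coordGrading n K) where
  toRingHom := MvPolynomial.map τ
  map_mem := by
    intro i p hp
    exact IsHomogeneous.map ((mem_homogeneousSubmodule i p).1 hp) τ

/-- A graded endomorphism with a graded right inverse induces an everywhere defined morphism on
`Proj`. -/
theorem irrelevant_le_of_rightInverse {n : ℕ} {K : Type u} [Field K]
    (f f' : GradedRingHom (coordGrading n K) (coordGrading n K)) (h : ∀ p, f (f' p) = p) :
    HomogeneousIdeal.irrelevant (coordGrading n K) ≤
      (HomogeneousIdeal.irrelevant (coordGrading n K)).map f := by
  refine (HomogeneousIdeal.irrelevant_le _).2 fun i hi x hx => ?_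
  have h1 : f' x ∈ HomogeneousIdeal.irrelevant (coordGrading n K) :=
    HomogeneousIdeal.mem_irrelevant_of_mem _ hi (f'.map_mem hx)
  have h2 : f (f' x) ∈ (HomogeneousIdeal.irrelevant (coordGrading n K)).map f :=
    Ideal.mem_map_of_mem f h1
  rw [h x] at h2
  exact h2

theorem linearHom_linearHom_inv {n : ℕ} {K : Type u} [Field K]
    (M : GL (Fin (n + 1)) K) (p : MvPolynomial (Fin (n + 1)) K) :
    linearHom M.1 (linearHom M⁻¹.1 p) = p := by
  have key : ((aeval (fun i => ∑ j, C (M.1 i j) * X j) :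
      MvPolynomial (Fin (n + 1)) K →ₐ[K] MvPolynomial (Fin (n + 1)) K).comp
      (aeval (fun i => ∑ j, C (M⁻¹.1 i j) * X j))) = AlgHom.id K _ := by
    ext1 i
    have hM : M⁻¹.1 * M.1 = 1 := M.inv_mul
    simp only [AlgHom.comp_apply, aeval_X, map_sum, map_mul, algHom_C, algebraMap_eq,
      AlgHom.id_apply, Finset.mul_sum]
    rw [Finset.sum_comm]
    simp only [← mul_assoc, ← C_mul, ← Finset.sum_mul, ← map_sum, ← Matrix.mul_apply, hM]
    simp [Matrix.one_apply, apply_ite C, ite_mul]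
  exact DFunLike.congr_fun key p

/-- The automorphism `[M]` of projective space: it sends the point with coordinate column `x` to
the point with coordinate column `M x`. -/
def projLinear {n : ℕ} {K : Type u} [Field K] (M : GL (Fin (n + 1)) K) :
    (projSpace n K).left ⟶ (projSpace n K).left :=
  Proj.map (linearHom M.1)
    (irrelevant_le_of_rightInverse _ (linearHom M⁻¹.1) (linearHom_linearHom_inv M))

/-- The action of `g ∈ Gal(L/k)` on projective space over `L`: it sends the point with
coordinates `[x₀ : … : xₙ]` to `[g x₀ : … : g xₙ]`. As a morphism of schemes it lies over
`Spec (g⁻¹)`. -/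
def projGalois (n : ℕ) {k L : Type u} [Field k] [Field L] [Algebra k L] (g : L ≃ₐ[k] L) :
    (projSpace n L).left ⟶ (projSpace n L).left :=
  Proj.map (coeffHom n ((g⁻¹ : L ≃ₐ[k] L) : L →+* L))
    (irrelevant_le_of_rightInverse _ (coeffHom n (g : L →+* L)) (fun p => by
      change MvPolynomial.map _ (MvPolynomial.map _ p) = p
      rw [MvPolynomial.map_map]
      convert MvPolynomial.map_id p
      ext x
      exact g.symm_apply_apply x))

/-! ### Base change and the Galois action on it -/

/-- The base change `S_L = S ×_k L`, as a functor. -/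
abbrev baseChange (k L : Type u) [Field k] [Field L] [Algebra k L] :
    Over (Spec (CommRingCat.of k)) ⥤ Over (Spec (CommRingCat.of L)) :=
  Over.pullback (Spec.map (CommRingCat.ofHom (algebraMap k L)))

/-- The action of `g ∈ Gal(L/k)` on `S_L = S ×_k L` through the second factor. -/
def galoisAction {k L : Type u} [Field k] [Field L] [Algebra k L]
    (S : Over (Spec (CommRingCat.of k))) (g : L ≃ₐ[k] L) :
    ((baseChange k L).obj S).left ⟶ ((baseChange k L).obj S).left :=
  pullback.map S.hom (Spec.map (CommRingCat.ofHom (algebraMap k L)))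
    S.hom (Spec.map (CommRingCat.ofHom (algebraMap k L)))
    (𝟙 _) (Spec.map (CommRingCat.ofHom ((g⁻¹ : L ≃ₐ[k] L) : L →+* L))) (𝟙 _)
    (by simp)
    (by
      rw [Category.comp_id, ← Spec.map_comp, ← CommRingCat.ofHom_comp]
      congr 2
      ext x
      exact ((g⁻¹ : L ≃ₐ[k] L).commutes x).symm)

/-! ### Severi–Brauer surfaces -/

/-- A Severi–Brauer surface over `k`: a smooth projective `k`-scheme that becomes isomorphic to
the projective plane over an algebraic closure of `k`. -/
structure IsSeveriBrauerSurface {k : Type u} [Field k] (S : Over (Spec (CommRingCat.of k))) :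
    Prop where
  smooth : Smooth S.hom
  projective : ∃ (n : ℕ) (i : S ⟶ projSpace n k), IsClosedImmersion i.left
  split : Nonempty ((baseChange k (AlgebraicClosure k)).obj S ≅ projSpace 2 (AlgebraicClosure k))

/-- `S` is trivial if it is isomorphic to the projective plane over `k` itself. -/
def IsTrivial {k : Type u} [Field k] (S : Over (Spec (CommRingCat.of k))) : Prop :=
  Nonempty (S ≅ projSpace 2 k)

/-- `A_g`, `g ∈ Gal(L/k)`, are matrices with `φ ∘ g ∘ φ⁻¹ = [A_g] ∘ g` for the `L`-isomorphism
`φ : S_L ≅ ℙ²_L`. -/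
def IsCocycleOf {k L : Type u} [Field k] [Field L] [Algebra k L]
    {S : Over (Spec (CommRingCat.of k))} (φ : (baseChange k L).obj S ≅ projSpace 2 L)
    (a : (L ≃ₐ[k] L) → GL (Fin 3) L) : Prop :=
  ∀ g : L ≃ₐ[k] L,
    φ.inv.left ≫ galoisAction S g ≫ φ.hom.left = projGalois 2 g ≫ projLinear (a g)

/-- Entrywise Galois action on invertible matrices, `A ↦ A^g`. -/
def matrixGalois {k L : Type u} [Field k] [Field L] [Algebra k L] (g : L ≃ₐ[k] L) :
    GL (Fin 3) L →* GL (Fin 3) L :=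
  Matrix.GeneralLinearGroup.map (g : L →+* L)

/-! ### The opposite surface -/

/-- The Severi–Brauer surface `S` and the algebra `A` of dimension `9` correspond to each other:
over some finite Galois extension `L/k`, for suitable isomorphisms `S_L ≅ ℙ²_L` and
`f : L ⊗ A ≅ M₃(L)`, both are given by the same cocycle with values in `PGL₃(L)`, which acts on
`ℙ²_L` linearly and on `M₃(L)` by conjugation. -/
def Corresponds {k : Type u} [Field k] (S : Over (Spec (CommRingCat.of k)))
    (A : Type u) [Ring A] [Algebra k A] : Prop :=
  ∃ (L : Type u) (_ : Field L) (_ : Algebra k L) (_ : FiniteDimensional k L) (_ : IsGalois k L)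
    (φ : (baseChange k L).obj S ≅ projSpace 2 L) (a : (L ≃ₐ[k] L) → GL (Fin 3) L)
    (f : (L ⊗[k] A) ≃ₐ[L] Matrix (Fin 3) (Fin 3) L),
    IsCocycleOf φ a ∧
    ∀ (g : L ≃ₐ[k] L) (x : L ⊗[k] A),
      f (Algebra.TensorProduct.map (g : L →ₐ[k] L) (AlgHom.id k A) x) =
        (a g).1 * (f x).map g * (a g)⁻¹.1

/-- `T` is the opposite surface `S^op` of `S`: there is a central simple algebra `A` of dimension
`9` such that `S` corresponds to `A` and `T` corresponds to the opposite algebra of `A`. -/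
def IsOpposite {k : Type u} [Field k] (S T : Over (Spec (CommRingCat.of k))) : Prop :=
  ∃ (A : Type u) (_ : Ring A) (_ : Algebra k A),
    Algebra.IsCentral k A ∧ IsSimpleRing A ∧ Module.finrank k A = 9 ∧
    Corresponds S A ∧ Corresponds T Aᵐᵒᵖ

/-! ### The determinant -/

/-- The group `k* / (k*)³`. -/
abbrev UnitsModCubes (k : Type u) [Field k] : Type u :=
  kˣ ⧸ (powMonoidHom 3 : kˣ →* kˣ).range

/-- The matrix `A` is an affine representant of `α ∈ Aut_k(S)` with respect to the isomorphism
`φ : S_L ≅ ℙ²_L` and the matrices `A_g`: it represents `φ ∘ α ∘ φ⁻¹`, and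
`A^g = A_g⁻¹ A A_g` for all `g ∈ Gal(L/k)`. -/
def IsAffineRepresentant {k L : Type u} [Field k] [Field L] [Algebra k L]
    {S : Over (Spec (CommRingCat.of k))} (φ : (baseChange k L).obj S ≅ projSpace 2 L)
    (a : (L ≃ₐ[k] L) → GL (Fin 3) L) (α : Aut S) (A : GL (Fin 3) L) : Prop :=
  (φ.inv ≫ (baseChange k L).map α.hom ≫ φ.hom).left = projLinear A ∧
  ∀ g : L ≃ₐ[k] L, matrixGalois g A = (a g)⁻¹ * A * a g

/-- `det α = c` in `k* / (k*)³`: the class `c` is that of the determinant of an affine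
representant of `α` over some finite Galois extension of `k`. -/
def HasDet {k : Type u} [Field k] {S : Over (Spec (CommRingCat.of k))} (α : Aut S)
    (c : UnitsModCubes k) : Prop :=
  ∃ (L : Type u) (_ : Field L) (_ : Algebra k L) (_ : FiniteDimensional k L) (_ : IsGalois k L)
    (φ : (baseChange k L).obj S ≅ projSpace 2 L) (a : (L ≃ₐ[k] L) → GL (Fin 3) L)
    (A : GL (Fin 3) L) (d : kˣ),
    IsCocycleOf φ a ∧ IsAffineRepresentant φ a α A ∧
    A.1.det = algebraMap k L d ∧ c = QuotientGroup.mk d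

/-- The image `det(Aut_k(S))` in `k* / (k*)³`. -/
def detImage {k : Type u} [Field k] (S : Over (Spec (CommRingCat.of k))) :
    Set (UnitsModCubes k) :=
  {c | ∃ α : Aut S, HasDet α c}

end SeveriBrauer

end

/-! Let `S` correspond to `A` through the matrices `A_g` and `f : L ⊗ A ≅ M₃(L)`. The condition `M^g
= A_g⁻¹ M A_g` on an affine representant reads `M = A_g M^g A_g⁻¹`, which says that `f⁻¹(M)` is
fixed by the Galois group, hence that `M = f(1 ⊗ x)` with `x` in `A`. So `det(Aut_k(S))` is the set
of classes of the nonzero reduced norms of elements of `A`. The opposite algebra has the same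
elements with the same reduced norms: transposing a matrix representation of `A` gives one of `Aᵐᵒᵖ`
and keeps determinants.

Three facts make this precise. The reduced norm does not depend on the representation, since
automorphisms of a matrix algebra are inner (`det_algEquiv_apply`, `det_eq_of_span_range_eq_top`,
`det_op_eq`). The determinant of an automorphism of `S` can be computed with any splitting: over a
compositum two splittings differ by an automorphism of the projective plane, which is linear
(`exists_eq_projLinear`), so the representants are conjugate (`conj_map_eq`,
`exists_compatible_of_hasDet`). Finally, each compatible matrix comes from an automorphism of `S`,
by Galois descent along the faithfully flat projection from `ℙ²_L` (`exists_aut`).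

Linearity is proved by unique factorization. An endomorphism of projective space is given at the
generic point by homogeneous polynomials of one degree without common factor, and these describe it
at every point. Composing the polynomials of an automorphism with those of its inverse gives `Q xᵢ`.
A prime containing `Q` but not all the variables would be a point where all coordinates of the
composite vanish, so `Q` is constant, and comparing degrees shows that both families are linear. -/

noncomputable section

namespace SeveriBrauer

/-! ### Points of `Proj` given by ring homomorphisms -/

section PointOf

open HomogeneousLocalization

variable {A B C σ τ : Type u} [CommRing A] [CommRing B] [CommRing C]
  [SetLike σ A] [AddSubgroupClass σ A] {𝒜 : ℕ → σ} [GradedRing 𝒜]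

/-- The evaluation `a / s ^ n ↦ φ a / (φ s) ^ n` on the homogeneous localization at `s`. -/
def awayEval (𝒜 : ℕ → σ) [GradedRing 𝒜] (φ : A →+* B) (s : A) (hu : IsUnit (φ s)) :
    Away 𝒜 s →+* B :=
  (IsLocalization.Away.lift (S := Localization.Away s) s hu).comp
    (algebraMap (Away 𝒜 s) (Localization.Away s))

theorem awayEval_mk (φ : A →+* B) (s : A) (hu : IsUnit (φ s)) {m : ℕ} (hs : s ∈ 𝒜 m) (n : ℕ)
    (a : A) (ha : a ∈ 𝒜 (n • m)) :
    awayEval 𝒜 φ s hu (Away.mk 𝒜 hs n a ha) * φ s ^ n = φ a := by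
  have h1 : Localization.mk a (⟨s ^ n, n, rfl⟩ : Submonoid.powers s) *
      algebraMap A (Localization.Away s) (s ^ n) = algebraMap A _ a := by
    rw [Localization.mk_eq_mk']
    exact IsLocalization.mk'_spec (Localization.Away s) a
      (⟨s ^ n, n, rfl⟩ : Submonoid.powers s)
  have h2 := congrArg (IsLocalization.Away.lift (S := Localization.Away s) s hu) h1
  rw [map_mul, IsLocalization.Away.lift_eq, IsLocalization.Away.lift_eq, map_pow] at h2
  exact h2

theorem awayEval_unique (φ : A →+* B) (s : A) (hu : IsUnit (φ s)) {m : ℕ} (hs : s ∈ 𝒜 m)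
    (ρ : Away 𝒜 s →+* B)
    (h : ∀ n a ha, ρ (Away.mk 𝒜 hs n a ha) * φ s ^ n = φ a) : ρ = awayEval 𝒜 φ s hu := by
  ext x
  obtain ⟨n, a, ha, rfl⟩ := Away.mk_surjective 𝒜 hs x
  refine (hu.pow n).mul_right_cancel ?_
  rw [h, awayEval_mk]

/-- The point of `Proj 𝒜` with values in `B` given by a ring homomorphism `φ` that is invertible
at some homogeneous element `s` of positive degree. -/
def pointOf (φ : A →+* B) {s : A} {m : ℕ} (hs : s ∈ 𝒜 m) (hm : 0 < m) (hu : IsUnit (φ s)) :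
    Spec (CommRingCat.of B) ⟶ Proj 𝒜 :=
  Spec.map (CommRingCat.ofHom (awayEval 𝒜 φ s hu)) ≫ Proj.awayι 𝒜 s hs hm

/-- Shrinks the chart from `D₊(s)` to `D₊(st)`. This allows two charts through which the same point
factors to be compared on their intersection. -/
theorem pointOf_eq_mul (φ : A →+* B) {s t : A} {m m' : ℕ} (hs : s ∈ 𝒜 m) (hm : 0 < m)
    (hu : IsUnit (φ s)) (ht : t ∈ 𝒜 m') (hu' : IsUnit (φ t)) :
    pointOf φ hs hm hu = pointOf φ (SetLike.mul_mem_graded hs ht) (hm.trans_le (m.le_add_right m'))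
      (by rw [map_mul]; exact hu.mul hu') := by
  rw [pointOf, pointOf, ← Proj.SpecMap_awayMap_awayι 𝒜 hs hm ht rfl, ← Category.assoc,
    ← Spec.map_comp, ← CommRingCat.ofHom_comp]
  congr 3
  refine (awayEval_unique _ _ _ hs _ fun n a ha => ?_).symm
  have h := awayEval_mk (𝒜 := 𝒜) φ (s * t) (by rw [map_mul]; exact hu.mul hu')
    (SetLike.mul_mem_graded hs ht) n (a * t ^ n)
    (by rw [smul_add]; exact SetLike.mul_mem_graded ha (SetLike.pow_mem_graded n ht))
  rw [RingHom.comp_apply, awayMap_mk]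
  refine (hu'.pow n).mul_right_cancel ?_
  have e : φ s ^ n * φ t ^ n = φ (s * t) ^ n := by rw [map_mul, mul_pow]
  rw [mul_assoc, e, h, map_mul, map_pow]

theorem pointOf_indep (φ : A →+* B) {s t : A} {m m' : ℕ} (hs : s ∈ 𝒜 m) (hm : 0 < m)
    (hu : IsUnit (φ s)) (ht : t ∈ 𝒜 m') (hm' : 0 < m') (hu' : IsUnit (φ t)) :
    pointOf φ hs hm hu = pointOf φ ht hm' hu' := by
  rw [pointOf_eq_mul φ hs hm hu ht hu', pointOf_eq_mul φ ht hm' hu' hs hu]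
  congr 1
  · rw [mul_comm]
  · rw [add_comm]

theorem specMap_pointOf (φ : A →+* B) (θ : B →+* C) {s : A} {m : ℕ} (hs : s ∈ 𝒜 m) (hm : 0 < m)
    (hu : IsUnit (φ s)) :
    Spec.map (CommRingCat.ofHom θ) ≫ pointOf φ hs hm hu =
      pointOf (θ.comp φ) hs hm (hu.map θ) := by
  rw [pointOf, pointOf, ← Category.assoc, ← Spec.map_comp, ← CommRingCat.ofHom_comp]
  congr 3
  refine awayEval_unique _ _ _ hs _ fun n a ha => ?_
  rw [RingHom.comp_apply, RingHom.comp_apply, RingHom.comp_apply, ← awayEval_mk φ s hu hs n a ha,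
    map_mul, map_pow]

/-- Rescaling the homomorphism in each degree does not change the point. -/
theorem pointOf_eq_of_scale (φ ψ : A →+* B) (c : B) {s : A} {m : ℕ} (hs : s ∈ 𝒜 m) (hm : 0 < m)
    (hu : IsUnit (φ s)) (hu' : IsUnit (ψ s)) (h : ∀ n, ∀ a ∈ 𝒜 n, φ a = c ^ n * ψ a) :
    pointOf φ hs hm hu = pointOf ψ hs hm hu' := by
  rw [pointOf, pointOf]
  congr 3
  refine awayEval_unique _ _ _ hs _ fun n a ha => ?_
  refine (hu.pow n).mul_right_cancel ?_
  rw [mul_right_comm, awayEval_mk, h _ a ha, h _ s hs, mul_pow, smul_eq_mul]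
  ring

/-- Two homomorphisms that define the same point are proportional. -/
theorem mul_eq_mul_of_pointOf_eq (φ ψ : A →+* B) {s : A} {m : ℕ} (hs : s ∈ 𝒜 m) (hm : 0 < m)
    (hu : IsUnit (φ s)) (hu' : IsUnit (ψ s)) (h : pointOf φ hs hm hu = pointOf ψ hs hm hu')
    {a : A} (ha : a ∈ 𝒜 m) : φ a * ψ s = ψ a * φ s := by
  rw [pointOf, pointOf, cancel_mono] at h
  have h1 : awayEval 𝒜 φ s hu = awayEval 𝒜 ψ s hu' := by
    simpa using congrArg CommRingCat.Hom.hom (Spec.map_injective h)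
  have ha' : a ∈ 𝒜 (1 • m) := by rwa [one_smul]
  have h2 := awayEval_mk φ s hu hs 1 a ha'
  have h3 := awayEval_mk ψ s hu' hs 1 a ha'
  rw [pow_one] at h2 h3
  rw [← h2, ← h3, h1]
  ring

open Graded in
theorem pointOf_map [SetLike τ C] [AddSubgroupClass τ C] {𝒞 : ℕ → τ} [GradedRing 𝒞]
    (f : 𝒜 →+*ᵍ 𝒞) (hf : HomogeneousIdeal.irrelevant 𝒞 ≤ (HomogeneousIdeal.irrelevant 𝒜).map f)
    (φ : C →+* B) {s : A} {m : ℕ} (hs : s ∈ 𝒜 m) (hm : 0 < m) (hu : IsUnit (φ (f s))) :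
    pointOf (s := f s) φ (f.map_mem hs) hm hu ≫ Proj.map f hf =
      pointOf (φ.comp (f : A →+* C)) hs hm (by rwa [RingHom.comp_apply]) := by
  unfold pointOf
  rw [Category.assoc, Proj.awayι_comp_map f hf hm s hs, ← Category.assoc,
    ← Spec.map_comp, ← CommRingCat.ofHom_comp]
  congr 3
  refine awayEval_unique _ _ _ hs _ fun n a ha => ?_
  rw [RingHom.comp_apply, Away.map_mk]
  exact awayEval_mk φ (f s) hu (f.map_mem hs) n (f a) (f.map_mem ha)

/-- The point lands in `D₊(t)`, so the preimage of `D₊(t)` is everything. On the chart `D₊(s)` this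
open set is where `t ^ m / s ^ m'` is invertible, so that function evaluates to a unit. -/
theorem isUnit_of_pointOf_eq (φ ψ : A →+* B) {s t : A} {m m' : ℕ} (hs : s ∈ 𝒜 m) (hm : 0 < m)
    (hu : IsUnit (φ s)) (ht : t ∈ 𝒜 m') (hm' : 0 < m') (hu' : IsUnit (ψ t))
    (h : pointOf φ hs hm hu = pointOf ψ ht hm' hu') : IsUnit (φ t) := by
  have h1 : pointOf φ hs hm hu ⁻¹ᵁ Proj.basicOpen 𝒜 t = ⊤ := by
    rw [h, pointOf, Scheme.Hom.comp_preimage, ← Proj.opensRange_awayι 𝒜 t ht hm',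
      Scheme.Hom.preimage_opensRange]
    rfl
  rw [pointOf, Scheme.Hom.comp_preimage, Proj.awayι_preimage_basicOpen 𝒜 hs hm ht hm'] at h1
  have h2 : PrimeSpectrum.basicOpen (awayEval 𝒜 φ s hu (Away.isLocalizationElem hs ht)) = ⊤ := h1
  replace h2 : IsUnit (awayEval 𝒜 φ s hu (Away.isLocalizationElem hs ht)) := by
    by_contra hn
    obtain ⟨I, hI, hmem⟩ := exists_max_ideal_of_mem_nonunits hn
    have : (⟨I, hI.isPrime⟩ : PrimeSpectrum B) ∈ PrimeSpectrum.basicOpen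
        (awayEval 𝒜 φ s hu (Away.isLocalizationElem hs ht)) := h2 ▸ trivial
    exact this hmem
  have h3 := awayEval_mk φ s hu hs m' (t ^ m)
    (by convert SetLike.pow_mem_graded m ht using 2; exact mul_comm _ _)
  refine (isUnit_pow_iff hm.ne').1 ?_
  rw [← map_pow, ← h3]
  exact h2.mul (hu.pow m')

open Graded in
theorem projMap_toSpecZero [SetLike τ C] [AddSubgroupClass τ C] {𝒞 : ℕ → τ} [GradedRing 𝒞]
    {R R' : Type u} [CommRing R] [CommRing R']
    (f : 𝒜 →+*ᵍ 𝒞) (hf : HomogeneousIdeal.irrelevant 𝒞 ≤ (HomogeneousIdeal.irrelevant 𝒜).map f)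
    (κ : R →+* 𝒜 0) (κ' : R' →+* 𝒞 0) (θ : R →+* R') (h : ∀ a, f (κ a) = κ' (θ a)) :
    Proj.map f hf ≫ Proj.toSpecZero 𝒜 ≫ Spec.map (CommRingCat.ofHom κ) =
      (Proj.toSpecZero 𝒞 ≫ Spec.map (CommRingCat.ofHom κ')) ≫
        Spec.map (CommRingCat.ofHom θ) := by
  refine (Proj.mapAffineOpenCover f hf).openCover.hom_ext _ _
    fun (s : Σ i : PNat, 𝒜 i) => ?_
  change Proj.awayι 𝒞 (f s.2) (f.2 s.2.2) s.1.pos ≫ _ = Proj.awayι 𝒞 (f s.2) (f.2 s.2.2) s.1.pos ≫ _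
  rw [Proj.awayι_comp_map_assoc f hf s.1.pos _ s.2.2, Proj.awayι_toSpecZero_assoc, Category.assoc,
    Proj.awayι_toSpecZero_assoc]
  simp only [← Spec.map_comp, ← CommRingCat.ofHom_comp]
  congr 2
  ext a
  have hle : Submonoid.powers s.2.1 ≤ (Submonoid.powers (f s.2)).comap f :=
    Submonoid.powers_le.2 ⟨1, pow_one _⟩
  change (HomogeneousLocalization.map f hle (HomogeneousLocalization.mk
    ⟨0, κ a, ⟨1, SetLike.GradedOne.one_mem⟩, one_mem _⟩)).val =
    (HomogeneousLocalization.mk ⟨0, κ' (θ a), ⟨1, SetLike.GradedOne.one_mem⟩, one_mem _⟩).val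
  rw [HomogeneousLocalization.map_mk, HomogeneousLocalization.val_mk,
    HomogeneousLocalization.val_mk]
  simp [h]

end PointOf

/-! ### Points of projective space -/

section CoordPoint

open HomogeneousLocalization

variable {n : ℕ} {K B C : Type u} [Field K] [CommRing B] [CommRing C]

/-- Each monomial of degree `m` picks up `m` factors `c`. The same computation serves for rescaling
coordinates, for dehomogenization and for the substitution `xᵢ ↦ xᵢ T`. -/
theorem map_eq_pow_mul_of_isHomogeneous {ι : Type*} {R S : Type*} [CommRing R] [CommRing S]
    (φ ψ : MvPolynomial ι R →+* S) (c : S)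
    (hC : ∀ a, φ (MvPolynomial.C a) = ψ (MvPolynomial.C a)) (hX : ∀ i, φ (X i) = c * ψ (X i))
    {m : ℕ} {a : MvPolynomial ι R} (ha : a.IsHomogeneous m) : φ a = c ^ m * ψ a := by
  rw [a.as_sum, map_sum, map_sum, Finset.mul_sum]
  refine Finset.sum_congr rfl fun d hd => ?_
  have hdeg : d.sum (fun _ e => e) = m := by
    have := ha.degree_eq_sum_deg_support hd
    rw [Finsupp.sum, ← this]
  rw [monomial_eq, map_mul, map_mul, hC, Finsupp.prod, map_prod, map_prod, ← hdeg, Finsupp.sum,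
    ← Finset.prod_pow_eq_pow_sum, mul_left_comm, ← Finset.prod_mul_distrib]
  congr 1
  exact Finset.prod_congr rfl fun i _ => by rw [map_pow, map_pow, hX, mul_pow]

theorem X_mem_coordGrading (i : Fin (n + 1)) : (X i : MvPolynomial (Fin (n + 1)) K) ∈
    coordGrading n K 1 :=
  (mem_homogeneousSubmodule _ _).2 (isHomogeneous_X K i)

/-- The `B`-valued point of projective space with homogeneous coordinates `φ xᵢ`, of which the one
with index `i` is a unit. -/
def coordPoint (φ : MvPolynomial (Fin (n + 1)) K →+* B) (i : Fin (n + 1)) (hu : IsUnit (φ (X i))) :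
    Spec (CommRingCat.of B) ⟶ (projSpace n K).left :=
  pointOf φ (X_mem_coordGrading i) one_pos hu

theorem coordPoint_congr {φ ψ : MvPolynomial (Fin (n + 1)) K →+* B} (h : φ = ψ) (i : Fin (n + 1))
    (hu : IsUnit (φ (X i))) : coordPoint φ i hu = coordPoint ψ i (h ▸ hu) := by
  subst h; rfl

theorem coordPoint_indep (φ : MvPolynomial (Fin (n + 1)) K →+* B) (i j : Fin (n + 1))
    (hi : IsUnit (φ (X i))) (hj : IsUnit (φ (X j))) : coordPoint φ i hi = coordPoint φ j hj :=
  pointOf_indep _ _ _ _ _ _ _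

theorem specMap_coordPoint (φ : MvPolynomial (Fin (n + 1)) K →+* B) (θ : B →+* C)
    (i : Fin (n + 1)) (hi : IsUnit (φ (X i))) :
    Spec.map (CommRingCat.ofHom θ) ≫ coordPoint φ i hi = coordPoint (θ.comp φ) i (hi.map θ) :=
  specMap_pointOf _ _ _ _ _

theorem coordPoint_eq_of_scale (φ ψ : MvPolynomial (Fin (n + 1)) K →+* B) (c : B)
    (i : Fin (n + 1)) (hi : IsUnit (φ (X i))) (hi' : IsUnit (ψ (X i)))
    (hC : ∀ a, φ (MvPolynomial.C a) = ψ (MvPolynomial.C a)) (hX : ∀ i, φ (X i) = c * ψ (X i)) :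
    coordPoint φ i hi = coordPoint ψ i hi' :=
  pointOf_eq_of_scale _ _ c _ _ _ _ fun _ a ha =>
    map_eq_pow_mul_of_isHomogeneous φ ψ c hC hX ((mem_homogeneousSubmodule _ a).1 ha)

theorem mul_eq_mul_of_coordPoint_eq (φ ψ : MvPolynomial (Fin (n + 1)) K →+* B) (i : Fin (n + 1))
    (hi : IsUnit (φ (X i))) (hi' : IsUnit (ψ (X i))) (h : coordPoint φ i hi = coordPoint ψ i hi')
    (j : Fin (n + 1)) : φ (X j) * ψ (X i) = ψ (X j) * φ (X i) :=
  mul_eq_mul_of_pointOf_eq φ ψ (X_mem_coordGrading i) one_pos hi hi' h (X_mem_coordGrading j)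

theorem coordPoint_hom (φ : MvPolynomial (Fin (n + 1)) K →+* B) (i : Fin (n + 1))
    (hi : IsUnit (φ (X i))) :
    coordPoint φ i hi ≫ (projSpace n K).hom =
      Spec.map (CommRingCat.ofHom (φ.comp MvPolynomial.C)) := by
  change pointOf φ (X_mem_coordGrading i) one_pos hi ≫ Proj.toSpecZero (coordGrading n K) ≫
    Spec.map (CommRingCat.ofHom (algebraMap K (coordGrading n K 0))) = _
  rw [pointOf, Category.assoc, Proj.awayι_toSpecZero_assoc, ← Spec.map_comp, ← Spec.map_comp,
    ← CommRingCat.ofHom_comp, ← CommRingCat.ofHom_comp]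
  congr 2
  ext a
  have h := awayEval_mk (𝒜 := coordGrading n K) φ (X i) hi (X_mem_coordGrading i) 0
    (MvPolynomial.C a) (by rw [zero_smul]; exact isHomogeneous_C _ a)
  rw [pow_zero, mul_one] at h
  change awayEval (coordGrading n K) φ (X i) hi _ = φ (MvPolynomial.C a)
  rw [← h]
  congr 1

/-- The standard chart `xⱼ ≠ 0` of projective space. -/
abbrev Chart (n : ℕ) (K : Type u) [Field K] (j : Fin (n + 1)) : Type u :=
  Away (coordGrading n K) (X j : MvPolynomial (Fin (n + 1)) K)

/-- The coordinate functions `xᵢ / xⱼ` on the standard chart `xⱼ ≠ 0`. -/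
def chartCoord (n : ℕ) (K : Type u) [Field K] (j i : Fin (n + 1)) : Chart n K j :=
  Away.mk (coordGrading n K) (X_mem_coordGrading j) 1 (X i)
    (by rw [one_smul]; exact X_mem_coordGrading i)

/-- The structure map of the standard chart `xⱼ ≠ 0`. -/
def chartConst (n : ℕ) (K : Type u) [Field K] (j : Fin (n + 1)) :
    K →+* Chart n K j :=
  (fromZeroRingHom (coordGrading n K) _).comp (algebraMap K (coordGrading n K 0))

/-- Dehomogenization `xᵢ ↦ xᵢ / xⱼ`. -/
def dehomogenize (n : ℕ) (K : Type u) [Field K] (j : Fin (n + 1)) :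
    MvPolynomial (Fin (n + 1)) K →+* Chart n K j :=
  eval₂Hom (chartConst n K j) (chartCoord n K j)

theorem algebraMap_eq_pow_mul_dehomogenize (j : Fin (n + 1)) {m : ℕ}
    {a : MvPolynomial (Fin (n + 1)) K} (ha : a.IsHomogeneous m) :
    algebraMap _ (Localization.Away (X j : MvPolynomial (Fin (n + 1)) K)) a =
      algebraMap (MvPolynomial (Fin (n + 1)) K) _ (X j) ^ m * (dehomogenize n K j a).val := by
  refine map_eq_pow_mul_of_isHomogeneous (algebraMap (MvPolynomial (Fin (n + 1)) K) _)
    ((algebraMap (Chart n K j) (Localization.Away _)).comp (dehomogenize n K j))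
    _ (fun a => ?_) (fun i => ?_) ha
  · simp only [dehomogenize, RingHom.comp_apply, coe_eval₂Hom, eval₂_C]
    rfl
  · simp only [dehomogenize, RingHom.comp_apply, coe_eval₂Hom, eval₂_X,
      HomogeneousLocalization.algebraMap_apply, chartCoord, Away.val_mk]
    rw [Localization.mk_eq_mk', mul_comm]
    have := IsLocalization.mk'_spec (Localization.Away (X j : MvPolynomial (Fin (n + 1)) K))
      (X i : MvPolynomial (Fin (n + 1)) K)
      (⟨X j ^ 1, 1, rfl⟩ : Submonoid.powers (X j))
    exact this.symm.trans (congrArg (fun t => _ * algebraMap (MvPolynomial (Fin (n + 1)) K) _ t)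
      (pow_one _))

theorem mk_eq_dehomogenize (j : Fin (n + 1)) (m : ℕ) (a : MvPolynomial (Fin (n + 1)) K)
    (ha : a ∈ coordGrading n K (m • 1)) :
    Away.mk (coordGrading n K) (X_mem_coordGrading j) m a ha = dehomogenize n K j a := by
  ext
  have ha' : a.IsHomogeneous m := by
    have := (mem_homogeneousSubmodule _ a).1 ha
    rwa [smul_eq_mul, mul_one] at this
  refine ((IsLocalization.Away.algebraMap_isUnit
    (S := Localization.Away (X j : MvPolynomial (Fin (n + 1)) K))
    (X j : MvPolynomial (Fin (n + 1)) K)).pow m).mul_left_cancel ?_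
  rw [← algebraMap_eq_pow_mul_dehomogenize j ha', Away.val_mk, Localization.mk_eq_mk', mul_comm,
    ← map_pow]
  exact IsLocalization.mk'_spec (Localization.Away (X j : MvPolynomial (Fin (n + 1)) K)) a
      (⟨X j ^ m, m, rfl⟩ : Submonoid.powers _)

theorem dehomogenize_surjective (j : Fin (n + 1)) : Function.Surjective (dehomogenize n K j) := by
  intro x
  obtain ⟨m, a, ha, rfl⟩ := Away.mk_surjective _ (X_mem_coordGrading j) x
  exact ⟨a, (mk_eq_dehomogenize j m a ha).symm⟩

theorem dehomogenize_X_self (j : Fin (n + 1)) : dehomogenize n K j (X j) = 1 := by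
  rw [dehomogenize, coe_eval₂Hom, eval₂_X, chartCoord]
  ext
  rw [Away.val_mk, val_one, Localization.mk_eq_mk']
  simp

theorem eq_awayEval (j : Fin (n + 1)) (ρ : Chart n K j →+* B) :
    ρ = awayEval (coordGrading n K) (ρ.comp (dehomogenize n K j)) (X j)
      (by rw [RingHom.comp_apply, dehomogenize_X_self, map_one]; exact isUnit_one) := by
  refine awayEval_unique _ _ _ (X_mem_coordGrading j) _ fun m a ha => ?_
  rw [mk_eq_dehomogenize, RingHom.comp_apply, RingHom.comp_apply, dehomogenize_X_self, map_one,
    one_pow, mul_one]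

theorem irrelevant_le_span_X (n : ℕ) (K : Type u) [Field K] :
    (HomogeneousIdeal.irrelevant (coordGrading n K)).toIdeal ≤
      Ideal.span (Set.range (X : Fin (n + 1) → MvPolynomial (Fin (n + 1)) K)) := by
  refine (HomogeneousIdeal.toIdeal_irrelevant_le _).2 fun i hi a ha => ?_
  have ha' := (mem_homogeneousSubmodule _ a).1 ha
  change a ∈ Ideal.span _
  rw [← Set.image_univ, mem_ideal_span_X_image]
  intro d hd
  by_contra! hcon
  have h1 := ha'.degree_eq_sum_deg_support hd
  rw [Finset.sum_eq_zero fun j _ => hcon j trivial] at h1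
  exact hi.ne' h1

theorem iSup_basicOpen_X : ⨆ i : Fin (n + 1),
    Proj.basicOpen (coordGrading n K) (X i) = ⊤ :=
  Proj.iSup_basicOpen_eq_top _ _ (irrelevant_le_span_X n K)

/-- The only open set of the spectrum of a local ring that contains the closed point is the whole
space, so a chart containing the image of the closed point contains the whole image. -/
theorem exists_eq_specMap_awayι [IsLocalRing B]
    (f : Spec (CommRingCat.of B) ⟶ Proj (coordGrading n K)) :
    ∃ (j : Fin (n + 1)) (ρ : Chart n K j →+* B),
      f = Spec.map (CommRingCat.ofHom ρ) ≫ Proj.awayι (coordGrading n K) (X j)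
        (X_mem_coordGrading j) one_pos := by
  have hx : f (IsLocalRing.closedPoint B) ∈ (⊤ : (Proj (coordGrading n K)).Opens) := trivial
  rw [← iSup_basicOpen_X, TopologicalSpace.Opens.mem_iSup] at hx
  obtain ⟨j, hj⟩ := hx
  have hU : f ⁻¹ᵁ Proj.basicOpen (coordGrading n K) (X j) = ⊤ :=
    (IsLocalRing.closedPoint_mem_iff _).1 hj
  have hr : Set.range f ⊆ Set.range (Proj.awayι (coordGrading n K) (X j) (X_mem_coordGrading j)
      one_pos) := by
    rintro _ ⟨x, rfl⟩
    have hx : x ∈ f ⁻¹ᵁ Proj.basicOpen (coordGrading n K) (X j) := hU ▸ trivial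
    rw [← Proj.opensRange_awayι _ _ (X_mem_coordGrading j) one_pos] at hx
    exact hx
  refine ⟨j, (Spec.preimage (IsOpenImmersion.lift _ f hr)).hom, ?_⟩
  rw [CommRingCat.ofHom_hom, Spec.map_preimage, IsOpenImmersion.lift_fac]

/-- Every point with values in a local ring has homogeneous coordinates. -/
theorem exists_eq_coordPoint [IsLocalRing B] (f : Spec (CommRingCat.of B) ⟶ (projSpace n K).left) :
    ∃ (φ : MvPolynomial (Fin (n + 1)) K →+* B) (j : Fin (n + 1)) (h : φ (X j) = 1),
      f = coordPoint φ j (h ▸ isUnit_one) := by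
  obtain ⟨j, ρ, h⟩ := exists_eq_specMap_awayι f
  refine ⟨ρ.comp (dehomogenize n K j), j,
    by rw [RingHom.comp_apply, dehomogenize_X_self, map_one], ?_⟩
  rw [h, coordPoint, pointOf]
  congr 3
  exact eq_awayEval j ρ

/-- The chart `xⱼ ≠ 0` is itself a point with homogeneous coordinates `xᵢ / xⱼ`. -/
theorem awayι_eq_coordPoint (j : Fin (n + 1)) :
    Proj.awayι (coordGrading n K) (X j) (X_mem_coordGrading j) one_pos =
      coordPoint (dehomogenize n K j) j (dehomogenize_X_self (K := K) j ▸ isUnit_one) := by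
  rw [coordPoint, pointOf]
  have h := eq_awayEval j (RingHom.id (Chart n K j))
  simp only [RingHom.id_comp] at h
  rw [← h]
  change _ = Spec.map (𝟙 _) ≫ _
  rw [Spec.map_id, Category.id_comp]

end CoordPoint

/-! ### Comparison of homogeneous coordinates, and points under graded homomorphisms -/

section Maps

open HomogeneousLocalization Graded

variable {n : ℕ} {K K' B : Type u} [Field K] [Field K'] [CommRing B]

theorem isUnit_of_coordPoint_eq (φ ψ : MvPolynomial (Fin (n + 1)) K →+* B) (i k : Fin (n + 1))
    (hi : IsUnit (φ (X i))) (hk : IsUnit (ψ (X k))) (h : coordPoint φ i hi = coordPoint ψ k hk) :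
    IsUnit (φ (X k)) := 
  isUnit_of_pointOf_eq φ ψ _ _ hi (X_mem_coordGrading k) one_pos hk h

theorem coordPoint_cross (φ ψ : MvPolynomial (Fin (n + 1)) K →+* B) (i k : Fin (n + 1))
    (hi : IsUnit (φ (X i))) (hk : IsUnit (ψ (X k))) (h : coordPoint φ i hi = coordPoint ψ k hk)
    (a b : Fin (n + 1)) : φ (X a) * ψ (X b) = ψ (X a) * φ (X b) := by
  have hk' := isUnit_of_coordPoint_eq φ ψ i k hi hk h
  rw [coordPoint_indep φ i k hi hk'] at h
  have ha := mul_eq_mul_of_coordPoint_eq φ ψ k hk' hk h a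
  have hb := mul_eq_mul_of_coordPoint_eq φ ψ k hk' hk h b
  refine (hk.mul hk').mul_right_cancel ?_
  -- Both families are proportional through the index `k`, where both are units; eliminating the
  -- `k`-th coordinates gives the cross relation for arbitrary indices.
  linear_combination ψ (X b) * φ (X k) * ha - ψ (X a) * φ (X k) * hb

theorem coordPoint_map (f : GradedRingHom (coordGrading n K) (coordGrading n K'))
    (hf : HomogeneousIdeal.irrelevant (coordGrading n K') ≤
      (HomogeneousIdeal.irrelevant (coordGrading n K)).map f)
    (φ : MvPolynomial (Fin (n + 1)) K' →+* B) (i j : Fin (n + 1)) (hi : IsUnit (φ (X i)))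
    (hj : IsUnit (φ (f (X j)))) :
    (coordPoint φ i hi ≫ Proj.map f hf : Spec (CommRingCat.of B) ⟶ (projSpace n K).left) =
      coordPoint (φ.comp (f : MvPolynomial (Fin (n + 1)) K →+* MvPolynomial (Fin (n + 1)) K'))
        j (by rwa [RingHom.comp_apply]) := by
  rw [coordPoint, coordPoint, ← pointOf_map f hf φ (X_mem_coordGrading j) one_pos hj]
  congr 1
  exact pointOf_indep _ _ _ _ _ _ _

theorem projMap_hom (f : GradedRingHom (coordGrading n K) (coordGrading n K'))
    (hf : HomogeneousIdeal.irrelevant (coordGrading n K') ≤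
      (HomogeneousIdeal.irrelevant (coordGrading n K)).map f)
    (τ : K →+* K') (hτ : ∀ a, f (C a) = C (τ a)) :
    (Proj.map f hf : (projSpace n K').left ⟶ (projSpace n K).left) ≫ (projSpace n K).hom =
      (projSpace n K').hom ≫ Spec.map (CommRingCat.ofHom τ) :=
  projMap_toSpecZero f hf _ _ τ hτ

end Maps

/-! ### Linear automorphisms and extension of scalars on projective space -/

section Functoriality

open HomogeneousLocalization HomogeneousIdeal Graded

variable {n : ℕ} {K K' K'' B : Type u} [Field K] [Field K'] [Field K''] [CommRing B]

theorem projMap_congr {f f' : GradedRingHom (coordGrading n K) (coordGrading n K')} (h : f = f')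
    (hf : HomogeneousIdeal.irrelevant (coordGrading n K') ≤
      (HomogeneousIdeal.irrelevant (coordGrading n K)).map f) :
    Proj.map f hf = Proj.map f' (h ▸ hf) := by
  subst h; rfl

theorem projMap_comp_projMap (f : GradedRingHom (coordGrading n K) (coordGrading n K'))
    (g : GradedRingHom (coordGrading n K') (coordGrading n K''))
    {h : GradedRingHom (coordGrading n K) (coordGrading n K'')} (e : g.comp f = h)
    (hf : HomogeneousIdeal.irrelevant (coordGrading n K') ≤
      (HomogeneousIdeal.irrelevant (coordGrading n K)).map f)
    (hg : HomogeneousIdeal.irrelevant (coordGrading n K'') ≤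
      (HomogeneousIdeal.irrelevant (coordGrading n K')).map g)
    (hh : HomogeneousIdeal.irrelevant (coordGrading n K'') ≤
      (HomogeneousIdeal.irrelevant (coordGrading n K)).map h) :
    Proj.map g hg ≫ Proj.map f hf = Proj.map h hh := by
  subst e
  exact (Proj.map_comp f g hf hg).symm

theorem gradedHom_ext {f f' : GradedRingHom (coordGrading n K) (coordGrading n K')}
    (hC : ∀ a, f (C a) = f' (C a)) (hX : ∀ i, f (X i) = f' (X i)) : f = f' := by
  have : (f : MvPolynomial (Fin (n + 1)) K →+* MvPolynomial (Fin (n + 1)) K') = f' :=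
    MvPolynomial.ringHom_ext hC hX
  exact DFunLike.ext _ _ fun x => DFunLike.congr_fun this x

@[simp]
theorem linearHom_C (M : Matrix (Fin (n + 1)) (Fin (n + 1)) K) (a : K) :
    linearHom M (C a) = C a :=
  aeval_C _ a

@[simp]
theorem linearHom_X (M : Matrix (Fin (n + 1)) (Fin (n + 1)) K) (i : Fin (n + 1)) :
    linearHom M (X i) = ∑ j, C (M i j) * X j :=
  aeval_X _ i

/-- Extension of the coefficients along a homomorphism of fields. -/
def extHom (n : ℕ) (τ : K →+* K') : GradedRingHom (coordGrading n K) (coordGrading n K') where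
  toRingHom := MvPolynomial.map τ
  map_mem := by
    intro i p hp
    exact IsHomogeneous.map ((mem_homogeneousSubmodule i p).1 hp) τ

@[simp]
theorem extHom_C (τ : K →+* K') (a : K) : extHom n τ (C a) = C (τ a) :=
  map_C τ a

@[simp]
theorem extHom_X (τ : K →+* K') (i : Fin (n + 1)) : extHom n τ (X i) = X i :=
  map_X τ i

theorem irrelevant_le_map_extHom (τ : K →+* K') :
    HomogeneousIdeal.irrelevant (coordGrading n K') ≤
      (HomogeneousIdeal.irrelevant (coordGrading n K)).map (extHom n τ) := by
  change (HomogeneousIdeal.irrelevant (coordGrading n K')).toIdeal ≤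
    ((HomogeneousIdeal.irrelevant (coordGrading n K)).map (extHom n τ)).toIdeal
  refine (irrelevant_le_span_X n K').trans (Ideal.span_le.2 ?_)
  rintro _ ⟨i, rfl⟩
  have h : (X i : MvPolynomial (Fin (n + 1)) K) ∈
      HomogeneousIdeal.irrelevant (coordGrading n K) :=
    HomogeneousIdeal.mem_irrelevant_of_mem _ one_pos (X_mem_coordGrading i)
  have h2 : extHom n τ (X i) ∈ (HomogeneousIdeal.irrelevant (coordGrading n K)).map (extHom n τ) :=
    Ideal.mem_map_of_mem _ h
  rwa [extHom_X] at h2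

/-- The morphism `ℙⁿ_{K'} ⟶ ℙⁿ_K` induced by a homomorphism of fields `K →+* K'`. -/
def projExt (n : ℕ) (τ : K →+* K') : (projSpace n K').left ⟶ (projSpace n K).left :=
  Proj.map (extHom n τ) (irrelevant_le_map_extHom τ)

theorem projGalois_eq_projExt {k L : Type u} [Field k] [Field L] [Algebra k L] (g : L ≃ₐ[k] L) :
    projGalois n g = projExt n ((g⁻¹ : L ≃ₐ[k] L) : L →+* L) := rfl

theorem projExt_hom (τ : K →+* K') : projExt n τ ≫ (projSpace n K).hom =
    (projSpace n K').hom ≫ Spec.map (CommRingCat.ofHom τ) :=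
  projMap_hom _ _ τ fun a => extHom_C τ a

theorem projLinear_hom (M : GL (Fin (n + 1)) K) :
    projLinear M ≫ (projSpace n K).hom = (projSpace n K).hom := by
  have h := projMap_hom (linearHom M.1) (irrelevant_le_of_rightInverse _ (linearHom M⁻¹.1)
    (linearHom_linearHom_inv M)) (RingHom.id K) fun a => linearHom_C M.1 a
  have h2 : Spec.map (CommRingCat.ofHom (RingHom.id K)) = 𝟙 (Spec (CommRingCat.of K)) :=
    Spec.map_id _
  rw [h2, Category.comp_id] at h
  exact h

theorem linearHom_comp_linearHom (M N : GL (Fin (n + 1)) K) :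
    (linearHom M.1).comp (linearHom N.1) = linearHom (N * M).1 := by
  rw [Units.val_mul]
  refine gradedHom_ext (fun a => ?_) fun i => ?_
  · rw [GradedRingHom.comp_apply, linearHom_C, linearHom_C, linearHom_C]
  · rw [GradedRingHom.comp_apply, linearHom_X, linearHom_X, map_sum]
    simp only [map_mul, linearHom_C, linearHom_X, Matrix.mul_apply, map_sum,
      Finset.mul_sum, Finset.sum_mul]
    rw [Finset.sum_comm]
    simp only [mul_assoc]

theorem projLinear_comp (M N : GL (Fin (n + 1)) K) :
    projLinear M ≫ projLinear N = projLinear (N * M) :=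
  projMap_comp_projMap _ _ (linearHom_comp_linearHom M N) _ _ _

theorem projLinear_one : projLinear (1 : GL (Fin (n + 1)) K) = 𝟙 _ := by
  refine (projMap_congr (f' := GradedRingHom.id _) ?_ _).trans Proj.map_id
  refine gradedHom_ext (fun a => linearHom_C _ _) fun i => ?_
  rw [linearHom_X]
  change _ = X i
  simp [Matrix.one_apply, apply_ite C, ite_mul]

theorem projLinear_inv_comp (M : GL (Fin (n + 1)) K) : projLinear M⁻¹ ≫ projLinear M = 𝟙 _ := by
  rw [projLinear_comp, mul_inv_cancel, projLinear_one]

theorem projLinear_comp_inv (M : GL (Fin (n + 1)) K) : projLinear M ≫ projLinear M⁻¹ = 𝟙 _ := by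
  rw [projLinear_comp, inv_mul_cancel, projLinear_one]

theorem projExt_comp (τ : K →+* K') (τ' : K' →+* K'') :
    projExt n τ' ≫ projExt n τ = projExt n (τ'.comp τ) := by
  refine projMap_comp_projMap _ _ (gradedHom_ext (fun a => ?_) fun i => ?_) _ _ _
  · rw [GradedRingHom.comp_apply, extHom_C, extHom_C, extHom_C, RingHom.comp_apply]
  · rw [GradedRingHom.comp_apply, extHom_X, extHom_X, extHom_X]

theorem projExt_id : projExt n (RingHom.id K) = 𝟙 _ := by
  refine (projMap_congr (f' := GradedRingHom.id _) ?_ _).trans Proj.map_id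
  exact gradedHom_ext (fun a => extHom_C _ _) fun i => extHom_X _ _

theorem linearHom_comp_extHom (τ : K →+* K') (M : GL (Fin (n + 1)) K) :
    (linearHom (Matrix.GeneralLinearGroup.map τ M).1).comp (extHom n τ) =
      (extHom n τ).comp (linearHom M.1) := by
  refine gradedHom_ext (fun a => ?_) fun i => ?_
  · rw [GradedRingHom.comp_apply, GradedRingHom.comp_apply, extHom_C, linearHom_C, linearHom_C,
      extHom_C]
  · rw [GradedRingHom.comp_apply, GradedRingHom.comp_apply, extHom_X, linearHom_X, linearHom_X,
      map_sum]
    simp only [map_mul, extHom_C, extHom_X]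
    rfl

theorem projLinear_projExt (τ : K →+* K') (M : GL (Fin (n + 1)) K) :
    projLinear (Matrix.GeneralLinearGroup.map τ M) ≫ projExt n τ =
      projExt n τ ≫ projLinear M :=
  (projMap_comp_projMap _ _ (linearHom_comp_extHom τ M) _ _
    (irrelevant_le_map_comp (irrelevant_le_of_rightInverse _ (linearHom M⁻¹.1)
      (linearHom_linearHom_inv M)) (irrelevant_le_map_extHom τ))).trans
    (projMap_comp_projMap _ _ rfl _ _ _).symm

theorem coordPoint_projLinear (M : GL (Fin (n + 1)) K) (φ : MvPolynomial (Fin (n + 1)) K →+* B)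
    (i j : Fin (n + 1)) (hi : IsUnit (φ (X i))) (hj : IsUnit (φ (linearHom M.1 (X j)))) :
    coordPoint φ i hi ≫ projLinear M = coordPoint
      (φ.comp (linearHom M.1 : MvPolynomial (Fin (n + 1)) K →+* MvPolynomial (Fin (n + 1)) K))
      j (by rwa [RingHom.comp_apply]) :=
  coordPoint_map _ _ φ i j hi hj

theorem coordPoint_projExt (τ : K →+* K') (φ : MvPolynomial (Fin (n + 1)) K' →+* B)
    (i : Fin (n + 1)) (hi : IsUnit (φ (X i))) :
    coordPoint φ i hi ≫ projExt n τ = coordPoint (φ.comp (MvPolynomial.map τ)) i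
      (by rwa [RingHom.comp_apply, map_X]) :=
  coordPoint_map (extHom n τ) _ φ i i hi (by rwa [extHom_X])

end Functoriality

/-! ### Projective space over a larger field is a base change -/

section Extension

open HomogeneousLocalization Graded

variable {n : ℕ} {K K' K'' B : Type u} [Field K] [Field K'] [Field K''] [CommRing B]

theorem dehomogenize_comp_C (j : Fin (n + 1)) :
    (dehomogenize n K j).comp C = chartConst n K j :=
  eval₂Hom_comp_C _ _

theorem dehomogenize_X (j i : Fin (n + 1)) : dehomogenize n K j (X i) = chartCoord n K j i :=
  eval₂_X _ _ i

theorem chart_hom_ext {j : Fin (n + 1)} {ρ ρ' : Chart n K j →+* B}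
    (hC : ρ.comp (chartConst n K j) = ρ'.comp (chartConst n K j))
    (hX : ∀ i, ρ (chartCoord n K j i) = ρ' (chartCoord n K j i)) : ρ = ρ' := by
  have h : ρ.comp (dehomogenize n K j) = ρ'.comp (dehomogenize n K j) := by
    refine MvPolynomial.ringHom_ext (fun a => ?_) fun i => ?_
    · have := DFunLike.congr_fun hC a
      rwa [← dehomogenize_comp_C] at this
    · rw [RingHom.comp_apply, RingHom.comp_apply, dehomogenize_X, hX]
  ext x
  obtain ⟨a, rfl⟩ := dehomogenize_surjective j x
  exact DFunLike.congr_fun h a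

/-- A homomorphism from a chart is given by its values at the constants and at the `xᵢ / xⱼ`. -/
def chartLift (j : Fin (n + 1)) (φ : MvPolynomial (Fin (n + 1)) K →+* B) (h : φ (X j) = 1) :
    Chart n K j →+* B :=
  awayEval (coordGrading n K) φ (X j) (h ▸ isUnit_one)

theorem chartLift_chartCoord (j : Fin (n + 1)) (φ : MvPolynomial (Fin (n + 1)) K →+* B)
    (h : φ (X j) = 1) (i : Fin (n + 1)) : chartLift j φ h (chartCoord n K j i) = φ (X i) := by
  have := awayEval_mk (𝒜 := coordGrading n K) φ (X j) (h ▸ isUnit_one) (X_mem_coordGrading j) 1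
    (X i) (by rw [one_smul]; exact X_mem_coordGrading i)
  have e : φ (X j) ^ 1 = 1 := by rw [h, one_pow]
  rw [e, mul_one] at this
  exact this

theorem awayEval_comp_chartConst (j : Fin (n + 1)) (φ : MvPolynomial (Fin (n + 1)) K →+* B)
    (h : IsUnit (φ (X j))) :
    (awayEval (coordGrading n K) φ (X j) h).comp (chartConst n K j) = φ.comp C := by
  ext a
  have h := awayEval_mk (𝒜 := coordGrading n K) φ (X j) h (X_mem_coordGrading j) 0
    (MvPolynomial.C a) (by rw [zero_smul]; exact isHomogeneous_C _ a)
  rw [pow_zero, mul_one] at h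
  exact h

/-- A homomorphism out of a chart is freely given by its values on the constants and on the `xᵢ /
xⱼ`, subject only to `xⱼ / xⱼ ↦ 1`. Extending the constants from `K` to `K'` therefore has the
universal property of the pushout. -/
theorem isPushout_chart (τ : K →+* K') (j : Fin (n + 1))
    (h : ((dehomogenize n K' j).comp (MvPolynomial.map τ)) (X j) = 1) :
    IsPushout (CommRingCat.ofHom (chartConst n K j)) (CommRingCat.ofHom τ)
      (CommRingCat.ofHom (chartLift j ((dehomogenize n K' j).comp (MvPolynomial.map τ)) h))
      (CommRingCat.ofHom (chartConst n K' j)) := by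
  have hw : (chartLift j ((dehomogenize n K' j).comp (MvPolynomial.map τ)) h).comp
      (chartConst n K j) = (chartConst n K' j).comp τ := by
    rw [chartLift, awayEval_comp_chartConst, ← dehomogenize_comp_C]
    ext a
    simp
  have hX : ∀ i, chartLift j ((dehomogenize n K' j).comp (MvPolynomial.map τ)) h
      (chartCoord n K j i) = chartCoord n K' j i := fun i => by
    rw [chartLift_chartCoord, RingHom.comp_apply, map_X, dehomogenize_X]
  refine ⟨⟨by rw [← CommRingCat.ofHom_comp, ← CommRingCat.ofHom_comp, hw]⟩,
    ⟨PushoutCocone.IsColimit.mk _ (fun s => CommRingCat.ofHom (chartLift j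
      (eval₂Hom s.inr.hom fun i => s.inl.hom (chartCoord n K j i)) ?_)) ?_ ?_ ?_⟩⟩
  · rw [coe_eval₂Hom, eval₂_X, ← dehomogenize_X, dehomogenize_X_self, map_one]
  · intro s
    have hs := congrArg CommRingCat.Hom.hom s.condition
    refine CommRingCat.hom_ext (chart_hom_ext ?_ fun i => ?_)
    · simp only [CommRingCat.hom_comp, CommRingCat.hom_ofHom] at hs ⊢
      rw [RingHom.comp_assoc, hw, ← RingHom.comp_assoc, chartLift, awayEval_comp_chartConst,
        eval₂Hom_comp_C, ← hs]
    · simp only [CommRingCat.hom_comp, CommRingCat.hom_ofHom, RingHom.comp_apply]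
      rw [hX, chartLift_chartCoord, coe_eval₂Hom, eval₂_X]
  · intro s
    refine CommRingCat.hom_ext ?_
    simp only [CommRingCat.hom_comp, CommRingCat.hom_ofHom]
    rw [chartLift, awayEval_comp_chartConst, eval₂Hom_comp_C]
  · intro s m h1 h2
    refine CommRingCat.hom_ext (chart_hom_ext ?_ fun i => ?_)
    · have h2' := congrArg CommRingCat.Hom.hom h2
      simp only [CommRingCat.hom_comp, CommRingCat.hom_ofHom] at h2' ⊢
      rw [h2', chartLift, awayEval_comp_chartConst, eval₂Hom_comp_C]
    · have h1' := congrArg CommRingCat.Hom.hom h1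
      simp only [CommRingCat.hom_comp, CommRingCat.hom_ofHom] at h1' ⊢
      rw [chartLift_chartCoord, coe_eval₂Hom, eval₂_X, ← h1', RingHom.comp_apply, hX]

theorem awayι_hom (j : Fin (n + 1)) :
    Proj.awayι (coordGrading n K) (X j) (X_mem_coordGrading j) one_pos ≫ (projSpace n K).hom =
      Spec.map (CommRingCat.ofHom (chartConst n K j)) := by
  rw [awayι_eq_coordPoint]
  exact (coordPoint_hom _ _ _).trans (by rw [dehomogenize_comp_C])

theorem isPullback_awayι_projExt (τ : K →+* K') (j : Fin (n + 1))
    (h : ((dehomogenize n K' j).comp (MvPolynomial.map τ)) (X j) = 1) :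
    IsPullback (Spec.map (CommRingCat.ofHom
        (chartLift j ((dehomogenize n K' j).comp (MvPolynomial.map τ)) h)))
      (Proj.awayι (coordGrading n K') (X j) (X_mem_coordGrading j) one_pos)
      (Proj.awayι (coordGrading n K) (X j) (X_mem_coordGrading j) one_pos) (projExt n τ) := by
  refine IsOpenImmersion.isPullback _ _ _ _ ?_ ?_
  · have h1 := coordPoint_projExt τ (dehomogenize n K' j) j
      (dehomogenize_X_self (K := K') j ▸ isUnit_one)
    rw [← awayι_eq_coordPoint] at h1
    exact h1
  · rw [Proj.opensRange_awayι, Proj.opensRange_awayι]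
    refine (Proj.map_preimage_basicOpen (extHom n τ) (irrelevant_le_map_extHom τ) (X j)).trans ?_
    rw [extHom_X]

/-- The cover of projective space by the standard charts. -/
def chartCover (n : ℕ) (K : Type u) [Field K] : (Proj (coordGrading n K)).AffineOpenCover :=
  Proj.affineOpenCoverOfIrrelevantLESpan (coordGrading n K)
    (fun j : ULift.{u} (Fin (n + 1)) => (X j.down : MvPolynomial (Fin (n + 1)) K))
    (m := fun _ => 1) (fun j => X_mem_coordGrading j.down) (fun _ => one_pos) (by
      refine (irrelevant_le_span_X n K).trans (Ideal.span_mono ?_)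
      rintro _ ⟨i, rfl⟩
      exact ⟨⟨i⟩, rfl⟩)

/-- Being a pullback is local on the target factor, and over each standard chart the square is the
spectrum of `isPushout_chart`. -/
theorem isPullback_projExt (τ : K →+* K') :
    IsPullback (projExt n τ) (projSpace n K').hom (projSpace n K).hom
      (Spec.map (CommRingCat.ofHom τ)) := by
  refine Scheme.isPullback_of_openCover _ _ _ _ (chartCover n K).openCover fun i => ?_
  have h : ((dehomogenize n K' i.down).comp (MvPolynomial.map τ)) (X i.down) = 1 := by
    rw [RingHom.comp_apply, map_X, dehomogenize_X_self]
  have h1 := isPullback_awayι_projExt (n := n) τ i.down h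
  have h2 := isPullback_SpecMap_of_isPushout _ _ _ _ (isPushout_chart τ i.down h)
  rw [← awayι_hom, ← awayι_hom] at h2
  refine IsPullback.of_iso h2 h1.flip.isoPullback (Iso.refl _) (Iso.refl _) (Iso.refl _) ?_ ?_ ?_ ?_
  · exact (Category.comp_id _).trans h1.flip.isoPullback_hom_snd.symm
  · exact (Category.comp_id _).trans
      ((congrArg (· ≫ (projSpace n K').hom) h1.flip.isoPullback_hom_fst.symm).trans
        (Category.assoc _ _ _))
  · exact (Category.comp_id _).trans (Category.id_comp _).symm
  · exact (Category.comp_id _).trans (Category.id_comp _).symm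

end Extension

/-! ### Families of polynomials without common factor -/

section Primitive

/-- A family of ring elements is primitive if it has no common divisors, even after multiplication
by a common factor. -/
def IsPrimitiveFamily {ι R : Type*} [CommRing R] (G : ι → R) : Prop :=
  ∀ s f : R, (∀ i, f ∣ s * G i) → f ∣ s

/-- Divide by the greatest common divisor: the quotients have gcd one, so the gcd of the `s * G i`
is associated to `s`. -/
theorem exists_isPrimitiveFamily {ι R : Type*} [Fintype ι] [Nonempty ι] [CommRing R] [IsDomain R]
    [UniqueFactorizationMonoid R] (N : ι → R) :
    ∃ (F : R) (G : ι → R), (∀ i, N i = F * G i) ∧ IsPrimitiveFamily G := by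
  classical
  obtain ⟨_⟩ : Nonempty (NormalizedGCDMonoid R) := inferInstance
  obtain ⟨G, hG, hg⟩ := Finset.extract_gcd N Finset.univ_nonempty
  refine ⟨_, G, fun i => hG i (Finset.mem_univ i), fun s f h => ?_⟩
  have h1 : f ∣ Finset.univ.gcd fun i => s * G i := Finset.dvd_gcd fun i _ => h i
  have h2 := (Finset.gcd_mul_left' (s := Finset.univ) (f := G) s).dvd
  rw [hg, mul_one] at h2
  exact h1.trans h2

theorem isPrimitiveFamily_X {ι K : Type*} [Nontrivial ι] [Field K] :
    IsPrimitiveFamily (X : ι → MvPolynomial ι K) := by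
  intro s f h
  obtain ⟨i, j, hij⟩ := exists_pair_ne ι
  by_cases hs : s = 0
  · exact hs ▸ dvd_zero f
  obtain ⟨a, ha⟩ := h i
  obtain ⟨b, hb⟩ := h j
  have h1 : a * X j = b * X i := by
    have hf : f ≠ 0 := by
      rintro rfl
      rw [zero_mul] at ha
      exact mul_ne_zero hs (X_ne_zero i) ha
    refine mul_left_cancel₀ hf ?_
    linear_combination X i * hb - X j * ha
  have h2 : (X i : MvPolynomial ι K) ∣ a := by
    have : (X i : MvPolynomial ι K) ∣ a * X j := ⟨b, by rw [h1, mul_comm]⟩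
    rcases (MvPolynomial.X_prime (R := K) (i := i)).dvd_or_dvd this with h | h
    · exact h
    · rw [X_dvd_X] at h
      exact absurd h (by simpa using hij)
  obtain ⟨c, rfl⟩ := h2
  refine ⟨c, mul_right_cancel₀ (X_ne_zero i) ?_⟩
  rw [ha]; ring

end Primitive

/-! ### Factors of homogeneous polynomials -/

section Homogeneous

variable {ι R : Type*} [CommRing R]

/-- The substitution `xᵢ ↦ xᵢ T`. -/
def scaleHom (ι R : Type*) [CommRing R] : MvPolynomial ι R →+* Polynomial (MvPolynomial ι R) :=
  eval₂Hom (Polynomial.C.comp C) fun i => Polynomial.X * Polynomial.C (X i)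

theorem scaleHom_of_isHomogeneous {a : MvPolynomial ι R} {m : ℕ} (ha : a.IsHomogeneous m) :
    scaleHom ι R a = Polynomial.X ^ m * Polynomial.C a := by
  refine map_eq_pow_mul_of_isHomogeneous (scaleHom ι R) Polynomial.C Polynomial.X
    (fun a => ?_) (fun i => ?_) ha
  · exact eval₂_C _ _ a
  · exact eval₂_X _ _ i

theorem coeff_scaleHom (a : MvPolynomial ι R) (d : ℕ) :
    (scaleHom ι R a).coeff d = homogeneousComponent d a := by
  conv_lhs => rw [← sum_homogeneousComponent a]
  rw [map_sum, Polynomial.finsetSum_coeff]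
  have h : ∀ i ∈ Finset.range (a.totalDegree + 1),
      (scaleHom ι R (homogeneousComponent i a)).coeff d =
        if d = i then homogeneousComponent i a else 0 := fun i _ => by
    rw [scaleHom_of_isHomogeneous (homogeneousComponent_isHomogeneous _ a), mul_comm,
      Polynomial.coeff_C_mul_X_pow]
  rw [Finset.sum_congr rfl h, Finset.sum_ite_eq]
  split_ifs with hd
  · rfl
  · rw [Finset.mem_range, not_lt] at hd
    exact (homogeneousComponent_eq_zero _ _ hd).symm

theorem scaleHom_injective : Function.Injective (scaleHom ι R) := by
  have h : (Polynomial.evalRingHom 1).comp (scaleHom ι R) = RingHom.id _ := by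
    ext <;> simp [scaleHom]
  exact Function.LeftInverse.injective (DFunLike.congr_fun h)

/-- After `xᵢ ↦ xᵢ T` a homogeneous product is a single power of `T` with a coefficient. Degrees and
trailing degrees in `T` both add up over the factors, and a trailing degree never exceeds the
degree, so they coincide for each factor. -/
theorem isHomogeneous_of_mul [IsDomain R] {a b : MvPolynomial ι R} {m : ℕ}
    (h : (a * b).IsHomogeneous m) (h0 : a * b ≠ 0) : ∃ d, a.IsHomogeneous d := by
  have h1 : scaleHom ι R a * scaleHom ι R b = Polynomial.X ^ m * Polynomial.C (a * b) := by
    rw [← map_mul, scaleHom_of_isHomogeneous h]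
  have ha : scaleHom ι R a ≠ 0 := by
    rw [Ne, map_eq_zero_iff _ scaleHom_injective]; exact left_ne_zero_of_mul h0
  have hb : scaleHom ι R b ≠ 0 := by
    rw [Ne, map_eq_zero_iff _ scaleHom_injective]; exact right_ne_zero_of_mul h0
  have h2 := congrArg Polynomial.natDegree h1
  have h3 := congrArg Polynomial.natTrailingDegree h1
  rw [Polynomial.natDegree_mul ha hb, mul_comm (Polynomial.X ^ m),
    Polynomial.natDegree_C_mul_X_pow _ _ h0] at h2
  rw [Polynomial.natTrailingDegree_mul ha hb, mul_comm (Polynomial.X ^ m),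
    Polynomial.C_mul_X_pow_eq_monomial, Polynomial.natTrailingDegree_monomial h0] at h3
  have h4 := Polynomial.natTrailingDegree_le_natDegree (scaleHom ι R a)
  have h5 := Polynomial.natTrailingDegree_le_natDegree (scaleHom ι R b)
  refine ⟨(scaleHom ι R a).natDegree, ?_⟩
  have h6 : a = homogeneousComponent (scaleHom ι R a).natDegree a := by
    apply scaleHom_injective
    ext1 e
    rw [scaleHom_of_isHomogeneous (homogeneousComponent_isHomogeneous _ a), mul_comm,
      Polynomial.coeff_C_mul_X_pow]
    split_ifs with he
    · rw [he, coeff_scaleHom]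
    · rcases lt_or_gt_of_ne he with he | he
      · exact Polynomial.coeff_eq_zero_of_lt_natTrailingDegree (by omega)
      · exact Polynomial.coeff_eq_zero_of_natDegree_lt he
  have h7 := homogeneousComponent_isHomogeneous (scaleHom ι R a).natDegree a
  rwa [← h6] at h7

end Homogeneous

/-! ### Endomorphisms at the generic point -/

section Generic

open HomogeneousLocalization

variable {n : ℕ} {K : Type u} [Field K]

/-- Evaluation of polynomials at the homogeneous coordinates in the function field of the affine
cone. -/
abbrev toFractions (n : ℕ) (K : Type u) [Field K] :
    MvPolynomial (Fin (n + 1)) K →+* FractionRing (MvPolynomial (Fin (n + 1)) K) :=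
  algebraMap _ _

theorem toFractions_injective : Function.Injective (toFractions n K) :=
  IsFractionRing.injective _ _

theorem isUnit_toFractions {a : MvPolynomial (Fin (n + 1)) K} (ha : a ≠ 0) :
    IsUnit (toFractions n K a) :=
  isUnit_iff_ne_zero.2 ((map_ne_zero_iff _ toFractions_injective).2 ha)

/-- The generic point of projective space, with values in the function field of the cone. -/
def genericPoint (n : ℕ) (K : Type u) [Field K] :
    Spec (CommRingCat.of (FractionRing (MvPolynomial (Fin (n + 1)) K))) ⟶ (projSpace n K).left :=
  coordPoint (toFractions n K) 0 (isUnit_toFractions (X_ne_zero 0))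

theorem awayEval_toFractions_injective (j : Fin (n + 1)) :
    Function.Injective (awayEval (coordGrading n K) (toFractions n K) (X j)
      (isUnit_toFractions (X_ne_zero j))) := by
  rw [injective_iff_map_eq_zero]
  intro x hx
  obtain ⟨m, a, ha, rfl⟩ := Away.mk_surjective _ (X_mem_coordGrading j) x
  have h := awayEval_mk (toFractions n K) (X j) (isUnit_toFractions (X_ne_zero j))
    (X_mem_coordGrading j) m a ha
  rw [hx, zero_mul] at h
  have h0 : a = 0 := toFractions_injective (by rw [← h, map_zero])
  subst h0
  ext
  rw [Away.val_mk, Localization.mk_zero, val_zero]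

instance (j : Fin (n + 1)) : IsDomain (Chart n K j) :=
  (awayEval_toFractions_injective j).isDomain _

/-- The open immersion of the standard chart `xⱼ ≠ 0`. -/
def chartι (n : ℕ) (K : Type u) [Field K] (j : Fin (n + 1)) :
    Spec (CommRingCat.of (Chart n K j)) ⟶ (projSpace n K).left :=
  Proj.awayι (coordGrading n K) (X j) (X_mem_coordGrading j) one_pos

theorem chartι_hom (j : Fin (n + 1)) : chartι n K j ≫ (projSpace n K).hom =
    Spec.map (CommRingCat.ofHom (chartConst n K j)) :=
  awayι_hom j

theorem genericPoint_eq (j : Fin (n + 1)) : genericPoint n K =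
    Spec.map (CommRingCat.ofHom (awayEval (coordGrading n K) (toFractions n K) (X j)
      (isUnit_toFractions (X_ne_zero j)))) ≫ chartι n K j :=
  coordPoint_indep _ 0 j _ _

/-- On each chart, the spectrum of a domain, the generic point is dominant; morphisms from a reduced
scheme to a separated one that agree on a dominant source are equal. -/
theorem genericPoint_ext {Y : Scheme.{u}} [Y.IsSeparated] {f g : (projSpace n K).left ⟶ Y}
    (h : genericPoint n K ≫ f = genericPoint n K ≫ g) : f = g := by
  refine (chartCover n K).openCover.hom_ext _ _ fun (j : ULift (Fin (n + 1))) => ?_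
  change chartι n K j.down ≫ f = chartι n K j.down ≫ g
  have : IsDominant (Spec.map (CommRingCat.ofHom (awayEval (coordGrading n K) (toFractions n K)
      (X j.down) (isUnit_toFractions (X_ne_zero j.down))))) := by
    refine ⟨(PrimeSpectrum.denseRange_comap_iff_ker_le_nilRadical _).2 ?_⟩
    exact ((RingHom.injective_iff_ker_eq_bot _).1
      (awayEval_toFractions_injective j.down)).trans_le bot_le
  refine ext_of_isDominant (Spec.map (CommRingCat.ofHom (awayEval (coordGrading n K)
    (toFractions n K) (X j.down) (isUnit_toFractions (X_ne_zero j.down))))) ?_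
  rw [genericPoint_eq j.down, Category.assoc, Category.assoc] at h
  exact h

/-- Substitution of the polynomials `Nᵢ` for the variables. -/
abbrev subst (N : Fin (n + 1) → MvPolynomial (Fin (n + 1)) K) :
    MvPolynomial (Fin (n + 1)) K →+* MvPolynomial (Fin (n + 1)) K :=
  eval₂Hom C N

theorem exists_homogeneous_coordinates (ψ : (projSpace n K).left ⟶ (projSpace n K).left)
    (hψ : ψ ≫ (projSpace n K).hom = (projSpace n K).hom) :
    ∃ (m : ℕ) (N : Fin (n + 1) → MvPolynomial (Fin (n + 1)) K) (k : Fin (n + 1))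
      (hk : IsUnit ((toFractions n K).comp (subst N) (X k))), (∀ i, (N i).IsHomogeneous m) ∧
      genericPoint n K ≫ ψ = coordPoint ((toFractions n K).comp (subst N)) k hk := by
  classical
  let θ := awayEval (coordGrading n K) (toFractions n K) (X 0) (isUnit_toFractions (X_ne_zero 0))
  have hθ : Function.Injective θ := awayEval_toFractions_injective 0
  -- Coordinates are first found in the fraction field of the chart, which consists of quotients of
  -- degree zero. Clearing denominators then gives elements of the chart, whose numerators are
  -- homogeneous; the function field of the cone would not ensure this.
  let F := FractionRing (Chart n K 0)
  let θ' : F →+* FractionRing (MvPolynomial (Fin (n + 1)) K) := IsFractionRing.lift hθ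
  have hθ' : ∀ x, θ' (algebraMap _ F x) = θ x := fun x => IsFractionRing.lift_algebraMap hθ x
  obtain ⟨φ, j, hj, hφ⟩ := exists_eq_coordPoint
    (Spec.map (CommRingCat.ofHom (algebraMap (Chart n K 0) F)) ≫
      chartι n K 0 ≫ ψ)
  have hφC : φ.comp C = (algebraMap (Chart n K 0) F).comp (chartConst n K 0) := by
    have h := coordPoint_hom φ j (hj ▸ isUnit_one)
    rw [← hφ, Category.assoc, Category.assoc, hψ, chartι_hom, ← Spec.map_comp] at h
    exact (congrArg CommRingCat.Hom.hom (Spec.map_injective h)).symm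
  have hψ' : genericPoint n K ≫ ψ = coordPoint (θ'.comp φ) j
      (by rw [RingHom.comp_apply, hj, map_one]; exact isUnit_one) := by
    rw [← specMap_coordPoint φ θ' j (hj ▸ isUnit_one), ← hφ, genericPoint_eq 0,
      ← Category.assoc (Spec.map _) (Spec.map _), ← Spec.map_comp, ← CommRingCat.ofHom_comp,
      Category.assoc]
    congr 3
    ext x
    exact (hθ' x).symm
  obtain ⟨β, hβ⟩ := IsLocalization.exist_integer_multiples (nonZeroDivisors (Chart n K 0))
    Finset.univ fun i => φ (X i)
  choose α hα using fun i => hβ i (Finset.mem_univ i)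
  choose m a ha hma using fun i => Away.mk_surjective _ (X_mem_coordGrading 0) (α i)
  -- The numerators `a i` have different degrees `m i`; powers of `x₀` bring them all to the common
  -- degree `∑ i, m i`.
  have hcoord : ∀ i, toFractions n K (a i * X 0 ^ ((∑ i, m i) - m i)) =
      θ β * toFractions n K (X 0) ^ (∑ i, m i) * θ' (φ (X i)) := by
    intro i
    have h1 := awayEval_mk (toFractions n K) (X 0) (isUnit_toFractions (X_ne_zero 0))
      (X_mem_coordGrading 0) (m i) (a i) (ha i)
    have h2 := congrArg θ' (hα i)
    rw [hma] at h1
    rw [hθ', Algebra.smul_def, map_mul, hθ'] at h2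
    have h3 : m i + ((∑ i, m i) - m i) = ∑ i, m i :=
      Nat.add_sub_cancel' (Finset.single_le_sum (fun _ _ => Nat.zero_le _) (Finset.mem_univ i))
    rw [map_mul, map_pow, ← h1, mul_assoc, ← pow_add, h3, mul_right_comm, ← h2]
  have hc0 : θ β * toFractions n K (X 0) ^ (∑ i, m i) ≠ 0 :=
    mul_ne_zero ((map_ne_zero_iff _ hθ).2 (nonZeroDivisors.ne_zero β.2))
      (pow_ne_zero _ (isUnit_toFractions (X_ne_zero 0)).ne_zero)
  have hunit : IsUnit ((toFractions n K).comp (subst fun i => a i * X 0 ^ ((∑ i, m i) - m i))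
      (X j)) := by
    rw [RingHom.comp_apply, coe_eval₂Hom, eval₂_X, hcoord, hj, map_one, mul_one]
    exact isUnit_iff_ne_zero.2 hc0
  refine ⟨∑ i, m i, fun i => a i * X 0 ^ ((∑ i, m i) - m i), j, hunit, fun i => ?_, ?_⟩
  · have h1 : (a i).IsHomogeneous (m i) := by
      have := (mem_homogeneousSubmodule _ _).1 (ha i)
      rwa [smul_eq_mul, mul_one] at this
    have h2 := h1.mul (isHomogeneous_X_pow (R := K) (0 : Fin (n + 1)) ((∑ i, m i) - m i))
    rwa [Nat.add_sub_cancel' (Finset.single_le_sum (fun _ _ => Nat.zero_le _)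
      (Finset.mem_univ i))] at h2
  · rw [hψ']
    refine (coordPoint_eq_of_scale _ _ (θ β * toFractions n K (X 0) ^ (∑ i, m i)) j _ _
      (fun x => ?_) fun i => ?_).symm
    · have h1 := DFunLike.congr_fun hφC x
      rw [RingHom.comp_apply, RingHom.comp_apply] at h1
      rw [RingHom.comp_apply, RingHom.comp_apply, coe_eval₂Hom, eval₂_C, h1, hθ']
      exact (DFunLike.congr_fun (awayEval_comp_chartConst 0 (toFractions n K)
        (isUnit_toFractions (X_ne_zero 0))) x).symm
    · rw [RingHom.comp_apply, RingHom.comp_apply, coe_eval₂Hom, eval₂_X, hcoord]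

end Generic

/-! ### Primitive coordinates of an endomorphism -/

section Automorphisms

variable {n : ℕ} {K : Type u} [Field K]

/-- Every endomorphism of projective space is given generically by a primitive family of
homogeneous polynomials of the same degree. -/
theorem exists_primitive_coordinates (ψ : (projSpace n K).left ⟶ (projSpace n K).left)
    (hψ : ψ ≫ (projSpace n K).hom = (projSpace n K).hom) :
    ∃ (d : ℕ) (G : Fin (n + 1) → MvPolynomial (Fin (n + 1)) K) (k : Fin (n + 1))
      (hk : IsUnit ((toFractions n K).comp (subst G) (X k))), (∀ i, (G i).IsHomogeneous d) ∧
      IsPrimitiveFamily G ∧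
      genericPoint n K ≫ ψ = coordPoint ((toFractions n K).comp (subst G)) k hk := by
  obtain ⟨m, N, k, hk, hN, h⟩ := exists_homogeneous_coordinates ψ hψ
  obtain ⟨F, G, hFG, hG⟩ := exists_isPrimitiveFamily N
  have hX : ∀ (N : Fin (n + 1) → MvPolynomial (Fin (n + 1)) K) i,
      (toFractions n K).comp (subst N) (X i) = toFractions n K (N i) := fun N i => by
    rw [RingHom.comp_apply, coe_eval₂Hom, eval₂_X]
  have hNk : N k ≠ 0 := by
    rintro h0
    rw [hX, h0, map_zero] at hk
    exact not_isUnit_zero hk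
  have hF0 : F ≠ 0 := fun h0 => hNk (by rw [hFG, h0, zero_mul])
  have hGk : G k ≠ 0 := fun h0 => hNk (by rw [hFG, h0, mul_zero])
  have hcomm : ∀ i, (G i * F).IsHomogeneous m := fun i => by
    rw [mul_comm, ← hFG]; exact hN i
  obtain ⟨e, he⟩ := isHomogeneous_of_mul (a := F) (b := G k) (m := m)
    (by rw [← hFG]; exact hN k) (by rw [← hFG]; exact hNk)
  refine ⟨m - e, G, k, by rw [hX]; exact isUnit_toFractions hGk, fun i => ?_, hG, ?_⟩
  · by_cases hi : G i = 0
    · rw [hi]; exact isHomogeneous_zero _ _ _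
    · obtain ⟨d, hd⟩ := isHomogeneous_of_mul (hcomm i) (mul_ne_zero hi hF0)
      have := (hd.mul he).inj_right (hcomm i) (mul_ne_zero hi hF0)
      rwa [← this, Nat.add_sub_cancel]
  · rw [h]
    refine coordPoint_eq_of_scale _ _ (toFractions n K F) k _ _ (fun x => ?_) fun i => ?_
    · rw [RingHom.comp_apply, RingHom.comp_apply, coe_eval₂Hom, eval₂_C, coe_eval₂Hom, eval₂_C]
    · rw [hX, hX, hFG, map_mul]

/-- The primitive coordinates of an endomorphism describe it at all the points. -/
theorem coordPoint_comp_of_primitive (ψ : (projSpace n K).left ⟶ (projSpace n K).left)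
    (hψ : ψ ≫ (projSpace n K).hom = (projSpace n K).hom)
    {G : Fin (n + 1) → MvPolynomial (Fin (n + 1)) K} (hG : IsPrimitiveFamily G) {k : Fin (n + 1)}
    (hk : IsUnit ((toFractions n K).comp (subst G) (X k)))
    (h : genericPoint n K ≫ ψ = coordPoint ((toFractions n K).comp (subst G)) k hk)
    (p : Ideal (MvPolynomial (Fin (n + 1)) K)) [p.IsPrime] {i : Fin (n + 1)} (hi : X i ∉ p) :
    ∃ (j : Fin (n + 1)) (_ : G j ∉ p)
      (hj : IsUnit ((algebraMap _ (Localization.AtPrime p)).comp (subst G) (X j)))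
      (hi' : IsUnit (algebraMap _ (Localization.AtPrime p)
        (X i : MvPolynomial (Fin (n + 1)) K))),
      coordPoint (algebraMap _ (Localization.AtPrime p)) i hi' ≫ ψ =
        coordPoint ((algebraMap _ (Localization.AtPrime p)).comp (subst G)) j hj := by
  let ι : Localization.AtPrime p →+* FractionRing (MvPolynomial (Fin (n + 1)) K) :=
    IsLocalization.lift (M := p.primeCompl) (g := toFractions n K) fun s =>
      isUnit_toFractions fun h0 => s.2 (h0 ▸ p.zero_mem)
  have hι : ∀ a, ι (algebraMap _ _ a) = toFractions n K a := fun a => IsLocalization.lift_eq _ a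
  have hιinj : Function.Injective ι := by
    rw [injective_iff_map_eq_zero]
    intro x hx
    obtain ⟨a, s, rfl⟩ := IsLocalization.exists_mk'_eq p.primeCompl x
    have h1 := congrArg ι (IsLocalization.mk'_spec (Localization.AtPrime p) a s)
    rw [map_mul, hx, zero_mul, hι] at h1
    have : a = 0 := toFractions_injective (by rw [← h1, map_zero])
    rw [this, IsLocalization.mk'_zero]
  have hi' : IsUnit (algebraMap _ (Localization.AtPrime p)
      (X i : MvPolynomial (Fin (n + 1)) K)) :=
    IsLocalization.map_units (Localization.AtPrime p) (⟨X i, hi⟩ : p.primeCompl)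
  obtain ⟨φ, j, hj, hφ⟩ := exists_eq_coordPoint
    (coordPoint (algebraMap (MvPolynomial (Fin (n + 1)) K) (Localization.AtPrime p)) i hi' ≫ ψ)
  have hφC : φ.comp C =
      (algebraMap (MvPolynomial (Fin (n + 1)) K) (Localization.AtPrime p)).comp C := by
    have h1 := coordPoint_hom φ j (hj ▸ isUnit_one)
    rw [← hφ, Category.assoc, hψ, coordPoint_hom] at h1
    exact (congrArg CommRingCat.Hom.hom (Spec.map_injective h1)).symm
  have hgen : genericPoint n K =
      Spec.map (CommRingCat.ofHom ι) ≫ coordPoint (algebraMap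
        (MvPolynomial (Fin (n + 1)) K) (Localization.AtPrime p)) i hi' := by
    rw [specMap_coordPoint]
    have e : ι.comp (algebraMap (MvPolynomial (Fin (n + 1)) K) _) = toFractions n K := RingHom.ext hι
    rw [coordPoint_congr e]
    exact coordPoint_indep _ _ _ _ _
  have h2 : coordPoint (ι.comp φ) j ((hj ▸ isUnit_one : IsUnit (φ (X j))).map ι) =
      coordPoint ((toFractions n K).comp (subst G)) k hk := by
    rw [← h, hgen, Category.assoc, hφ, specMap_coordPoint]
  have h3 : ∀ a, toFractions n K (G a) = ι (φ (X a)) * toFractions n K (G j) := fun a => by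
    have := coordPoint_cross _ _ _ _ _ _ h2 a j
    simp only [RingHom.comp_apply, coe_eval₂Hom, eval₂_X, hj, map_one, mul_one] at this
    exact this.symm
  -- Write `φ (X a) = r a / s` with a common denominator `s` outside `p`. Then `s * G a = r a * G j`
  -- for all `a`, so primitivity gives `G j ∣ s`, and `G j` in `p` would put `s` in `p`.
  have hGj : G j ∉ p := by
    obtain ⟨s, hs⟩ := IsLocalization.exist_integer_multiples p.primeCompl
      Finset.univ fun i => φ (X i)
    choose r hr using fun i => hs i (Finset.mem_univ i)
    intro hmem
    refine s.2 (p.mem_of_dvd (hG s (G j) fun a => ⟨r a, toFractions_injective ?_⟩) hmem)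
    have h4 := congrArg ι (hr a)
    rw [Algebra.smul_def, map_mul, hι, hι] at h4
    rw [map_mul, map_mul, h3, h4]
    ring
  have hju : IsUnit ((algebraMap _ (Localization.AtPrime p)).comp (subst G) (X j)) := by
    rw [RingHom.comp_apply, coe_eval₂Hom, eval₂_X]
    exact IsLocalization.map_units (Localization.AtPrime p) (⟨G j, hGj⟩ : p.primeCompl)
  refine ⟨j, hGj, hju, hi', ?_⟩
  rw [hφ]
  refine (coordPoint_eq_of_scale _ _ (algebraMap _ (Localization.AtPrime p) (G j)) j _ _
    (fun x => ?_) fun a => hιinj ?_).symm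
  · rw [RingHom.comp_apply, coe_eval₂Hom, eval₂_C]
    exact (DFunLike.congr_fun hφC x).symm
  · rw [RingHom.comp_apply, coe_eval₂Hom, eval₂_X, map_mul, hι, hι, h3, mul_comm]

/-- The description of an endomorphism by primitive coordinates at a point with values in a
field. -/
theorem coordPoint_comp_of_primitive_field
    (ψ : (projSpace n K).left ⟶ (projSpace n K).left)
    (hψ : ψ ≫ (projSpace n K).hom = (projSpace n K).hom)
    {G : Fin (n + 1) → MvPolynomial (Fin (n + 1)) K} (hG : IsPrimitiveFamily G) {k : Fin (n + 1)}
    (hk : IsUnit ((toFractions n K).comp (subst G) (X k)))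
    (h : genericPoint n K ≫ ψ = coordPoint ((toFractions n K).comp (subst G)) k hk)
    {F : Type u} [Field F] (φ : MvPolynomial (Fin (n + 1)) K →+* F) {i : Fin (n + 1)}
    (hi : IsUnit (φ (X i))) :
    ∃ (j : Fin (n + 1)) (hj : IsUnit (φ.comp (subst G) (X j))),
      coordPoint φ i hi ≫ ψ = coordPoint (φ.comp (subst G)) j hj := by
  have hp : (RingHom.ker φ).IsPrime := RingHom.ker_isPrime φ
  obtain ⟨j, hGj, hj, hi', h1⟩ := coordPoint_comp_of_primitive ψ hψ hG hk h (RingHom.ker φ)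
    (i := i) (fun h0 => hi.ne_zero h0)
  let θ : Localization.AtPrime (RingHom.ker φ) →+* F :=
    IsLocalization.lift (M := (RingHom.ker φ).primeCompl) (g := φ) fun s =>
      isUnit_iff_ne_zero.2 s.2
  have hθ : θ.comp (algebraMap _ _) = φ := RingHom.ext fun a => IsLocalization.lift_eq _ a
  have hθ' : θ.comp ((algebraMap _ _).comp (subst G)) = φ.comp (subst G) := by
    rw [← RingHom.comp_assoc, hθ]
  refine ⟨j, hθ' ▸ hj.map θ, ?_⟩
  have h2 := congrArg (fun f => Spec.map (CommRingCat.ofHom θ) ≫ f) h1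
  rw [← Category.assoc, specMap_coordPoint, specMap_coordPoint, coordPoint_congr hθ,
    coordPoint_congr hθ'] at h2
  exact h2

end Automorphisms

/-! ### Automorphisms of projective space are linear -/

section Linear

variable {n : ℕ} {K : Type u} [Field K]

instance : (projSpace n K).left.IsSeparated :=
  inferInstanceAs (Scheme.IsSeparated (Proj (coordGrading n K)))

theorem subst_X (G : Fin (n + 1) → MvPolynomial (Fin (n + 1)) K) (i : Fin (n + 1)) :
    subst G (X i) = G i := eval₂_X _ _ i

theorem subst_C (G : Fin (n + 1) → MvPolynomial (Fin (n + 1)) K) (a : K) :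
    subst G (C a) = C a := eval₂_C _ _ a

theorem exists_eq_sum_of_isHomogeneous_one {p : MvPolynomial (Fin (n + 1)) K}
    (hp : p.IsHomogeneous 1) : ∃ c : Fin (n + 1) → K, p = ∑ j, C (c j) * X j := by
  rw [← mem_homogeneousSubmodule, homogeneousSubmodule_one_eq_span_X,
    Submodule.mem_span_range_iff_exists_fun] at hp
  obtain ⟨c, hc⟩ := hp
  exact ⟨c, by rw [← hc]; exact Finset.sum_congr rfl fun j _ => smul_eq_C_mul _ _⟩

theorem sum_C_mul_X_injective {c d : Fin (n + 1) → K}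
    (h : ∑ j, C (c j) * X j = (∑ j, C (d j) * X j : MvPolynomial (Fin (n + 1)) K)) : c = d := by
  classical
  funext i
  have h1 := congrArg (MvPolynomial.eval (Pi.single i 1)) h
  simpa [Pi.single_apply] using h1

/-- Primitive coordinates of mutually inverse endomorphisms invert each other up to a constant. -/
theorem exists_subst_eq_C_mul_X [Nontrivial (Fin (n + 1))]
    (ψ ψ' : (projSpace n K).left ⟶ (projSpace n K).left)
    (hψ : ψ ≫ (projSpace n K).hom = (projSpace n K).hom)
    (hψ' : ψ' ≫ (projSpace n K).hom = (projSpace n K).hom) (h : ψ ≫ ψ' = 𝟙 _)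
    {G H : Fin (n + 1) → MvPolynomial (Fin (n + 1)) K} (hG : IsPrimitiveFamily G)
    (hH : IsPrimitiveFamily H) {k l : Fin (n + 1)}
    (hk : IsUnit ((toFractions n K).comp (subst G) (X k)))
    (hl : IsUnit ((toFractions n K).comp (subst H) (X l)))
    (hGψ : genericPoint n K ≫ ψ = coordPoint ((toFractions n K).comp (subst G)) k hk)
    (hHψ : genericPoint n K ≫ ψ' = coordPoint ((toFractions n K).comp (subst H)) l hl) :
    ∃ c : K, c ≠ 0 ∧ ∀ i, subst G (H i) = C c * X i := by
  obtain ⟨j, hj, h1⟩ := coordPoint_comp_of_primitive_field ψ' hψ' hH hl hHψ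
    ((toFractions n K).comp (subst G)) hk
  rw [← hGψ, Category.assoc, h, Category.comp_id] at h1
  have h2 : ∀ a b, X a * subst G (H b) = subst G (H a) * X b := fun a b => by
    have := coordPoint_cross _ _ _ _ _ _ h1 a b
    simp only [RingHom.comp_apply, subst_X, ← map_mul] at this
    exact toFractions_injective this
  obtain ⟨Q, hQ⟩ : (X 0 : MvPolynomial (Fin (n + 1)) K) ∣ subst G (H 0) :=
    isPrimitiveFamily_X _ _ fun i => ⟨subst G (H i), (h2 0 i).symm⟩
  have h3 : ∀ i, subst G (H i) = Q * X i := fun i => by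
    refine mul_left_cancel₀ (X_ne_zero (R := K) (0 : Fin (n + 1))) ?_
    rw [h2, hQ]; ring
  -- Otherwise some prime `I` contains `Q` and misses a variable. It is a point of projective space;
  -- its image has a nonzero coordinate `G a`, and the image of that point has a nonzero coordinate,
  -- which is some `Q * X b` modulo `I`, a contradiction.
  have hQu : IsUnit Q := by
    by_contra hn
    obtain ⟨I, hI, hQI⟩ : ∃ I : Ideal (MvPolynomial (Fin (n + 1)) K), I.IsPrime ∧ Q ∈ I ∧
        ∃ i, X i ∉ I := by
      by_cases hQ0 : Q = 0
      · refine ⟨⊥, Ideal.isPrime_bot, by rw [hQ0]; exact Ideal.zero_mem _, 0, ?_⟩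
        exact X_ne_zero _
      obtain ⟨π, hπ, hπQ⟩ := WfDvdMonoid.exists_irreducible_factor hn hQ0
      refine ⟨Ideal.span {π}, (Ideal.span_singleton_prime hπ.ne_zero).2
        (UniqueFactorizationMonoid.irreducible_iff_prime.1 hπ),
        Ideal.mem_span_singleton.2 hπQ, ?_⟩
      by_contra! hcon
      refine hπ.not_isUnit (isUnit_of_dvd_one (isPrimitiveFamily_X _ _ fun i => ?_))
      rw [one_mul]
      exact Ideal.mem_span_singleton.1 (hcon i)
    obtain ⟨hQI, i, hi⟩ := hQI
    obtain ⟨a, ha, -⟩ := coordPoint_comp_of_primitive ψ hψ hG hk hGψ I hi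
    have hq : (I.comap (subst G)).IsPrime := Ideal.IsPrime.comap (hK := hI) _
    obtain ⟨b, hb, -⟩ := coordPoint_comp_of_primitive ψ' hψ' hH hl hHψ (I.comap (subst G))
      (i := a) (by rwa [Ideal.mem_comap, subst_X])
    refine hb ?_
    rw [Ideal.mem_comap, h3]
    exact I.mul_mem_right _ hQI
  obtain ⟨c, hc, hcQ⟩ := (isUnit_iff_eq_C_of_isReduced).1 hQu
  exact ⟨c, hc.ne_zero, fun i => by rw [h3, hcQ]⟩

theorem linearHom_eq_subst {M : Matrix (Fin (n + 1)) (Fin (n + 1)) K}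
    {G : Fin (n + 1) → MvPolynomial (Fin (n + 1)) K} (hM : ∀ i, G i = ∑ j, C (M i j) * X j) :
    (linearHom M : MvPolynomial (Fin (n + 1)) K →+* MvPolynomial (Fin (n + 1)) K) = subst G := by
  refine MvPolynomial.ringHom_ext (fun a => ?_) fun i => ?_
  · rw [subst_C]; exact linearHom_C _ _
  · rw [subst_X, hM]; exact linearHom_X _ _

theorem eq_projLinear_of_genericPoint_comp {ψ : (projSpace n K).left ⟶ (projSpace n K).left}
    {A : GL (Fin (n + 1)) K} {σ : MvPolynomial (Fin (n + 1)) K →+* MvPolynomial (Fin (n + 1)) K}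
    {k : Fin (n + 1)} (hk : IsUnit ((toFractions n K).comp σ (X k)))
    (hψ : genericPoint n K ≫ ψ = coordPoint ((toFractions n K).comp σ) k hk)
    (hσ : (linearHom A.1 : MvPolynomial (Fin (n + 1)) K →+* MvPolynomial (Fin (n + 1)) K) = σ) :
    ψ = projLinear A := by
  subst hσ
  exact genericPoint_ext (hψ.trans (coordPoint_projLinear A _ 0 k _ hk).symm)

/-- Substituting the coordinates of `ψ` into those of `ψ'` has degree `d * e`, but the result is `c
xᵢ` with `c` a nonzero constant. Hence `d = e = 1`, and the coefficient matrices are inverse to each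
other up to `c`. -/
theorem exists_eq_projLinear [Nontrivial (Fin (n + 1))]
    (ψ ψ' : (projSpace n K).left ⟶ (projSpace n K).left)
    (hψ : ψ ≫ (projSpace n K).hom = (projSpace n K).hom)
    (hψ' : ψ' ≫ (projSpace n K).hom = (projSpace n K).hom) (h : ψ ≫ ψ' = 𝟙 _) :
    ∃ M : GL (Fin (n + 1)) K, ψ = projLinear M := by
  obtain ⟨d, G, k, hk, hGd, hG, hGψ⟩ := exists_primitive_coordinates ψ hψ
  obtain ⟨e, H, l, hl, hHe, hH, hHψ⟩ := exists_primitive_coordinates ψ' hψ'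
  obtain ⟨c, hc, hGH⟩ := exists_subst_eq_C_mul_X ψ ψ' hψ hψ' h hG hH hk hl hGψ hHψ
  have hcX : (C c * X 0 : MvPolynomial (Fin (n + 1)) K) ≠ 0 :=
    mul_ne_zero (C_ne_zero.2 hc) (X_ne_zero 0)
  have hde : d * e = 1 := by
    have h1 : (subst G (H 0)).IsHomogeneous (d * e) := (hHe 0).aeval (R := K) G hGd
    rw [hGH] at h1
    exact h1.inj_right (isHomogeneous_C_mul_X c 0) hcX
  obtain rfl : d = 1 := Nat.eq_one_of_mul_eq_one_right hde
  obtain rfl : e = 1 := by rwa [one_mul] at hde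
  choose M hM using fun i => exists_eq_sum_of_isHomogeneous_one (hGd i)
  choose N hN using fun i => exists_eq_sum_of_isHomogeneous_one (hHe i)
  have hNM : (Matrix.of N * Matrix.of M) = c • (1 : Matrix (Fin (n + 1)) (Fin (n + 1)) K) := by
    funext i
    refine sum_C_mul_X_injective (n := n) (K := K) ?_
    have h1 := hGH i
    rw [hN i, map_sum] at h1
    simp only [map_mul, subst_C, subst_X, hM, Finset.mul_sum] at h1
    rw [Finset.sum_comm] at h1
    simp only [Matrix.mul_apply, Matrix.of_apply, map_sum, Finset.sum_mul, map_mul, mul_assoc]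
    refine h1.trans ?_
    simp [Matrix.one_apply, apply_ite C, ite_mul]
  have hdet : IsUnit (Matrix.of M).det := by
    have h1 := congrArg Matrix.det hNM
    rw [Matrix.det_mul, Matrix.det_smul, Matrix.det_one, mul_one] at h1
    exact isUnit_of_mul_isUnit_right (h1 ▸ (isUnit_iff_ne_zero.2 (pow_ne_zero _ hc)))
  obtain ⟨A, hA⟩ := (Matrix.isUnit_iff_isUnit_det _).2 hdet
  exact ⟨A, eq_projLinear_of_genericPoint_comp hk hGψ
    (linearHom_eq_subst fun i => by rw [hA, hM]; rfl)⟩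

theorem exists_smul_one_of_projLinear_eq_id {M : GL (Fin (n + 1)) K}
    (h : projLinear M = 𝟙 _) : ∃ c : K, M.1 = c • 1 := by
  classical
  obtain ⟨k, hk⟩ : ∃ k, IsUnit (toFractions n K (linearHom M.1 (X k))) := by
    by_contra! hcon
    have h0 : ∀ k, linearHom M.1 (X k) = 0 := fun k => by
      by_contra hne
      exact hcon k (isUnit_toFractions hne)
    have h1 := linearHom_linearHom_inv M (X 0)
    have h2 : (linearHom M⁻¹.1 (X 0) : MvPolynomial (Fin (n + 1)) K) =
      ∑ j, C (M⁻¹.1 0 j) * X j := linearHom_X _ _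
    rw [h2, map_sum, Finset.sum_eq_zero fun j _ => by rw [map_mul, h0, mul_zero]] at h1
    exact X_ne_zero (R := K) (0 : Fin (n + 1)) h1.symm
  have h1 : genericPoint n K ≫ projLinear M = genericPoint n K := by rw [h, Category.comp_id]
  rw [genericPoint, coordPoint_projLinear M _ 0 k _ hk] at h1
  have h2 : ∀ a b, (∑ j, C (M.1 a j) * X j) * X b =
      (X a * ∑ j, C (M.1 b j) * X j : MvPolynomial (Fin (n + 1)) K) := fun a b => by
    have h3 := coordPoint_cross _ _ _ _ _ _ h1 a b
    have h4 : toFractions n K (linearHom M.1 (X a) * X b) =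
      toFractions n K (X a * linearHom M.1 (X b)) := by
      rw [map_mul, map_mul]; exact h3
    have h5 := toFractions_injective h4
    have h6 : ∀ i, (linearHom M.1 (X i) : MvPolynomial (Fin (n + 1)) K) =
      ∑ j, C (M.1 i j) * X j := fun i => linearHom_X _ _
    rwa [h6, h6] at h5
  -- Evaluation at the `b`-th unit vector isolates the off-diagonal entry. The diagonal entries are
  -- compared below by evaluation at the vector of ones.
  have h3 : ∀ a b, a ≠ b → M.1 a b = 0 := fun a b hab => by
    simpa [Pi.single_apply, hab] using congrArg (MvPolynomial.eval (Pi.single b 1)) (h2 a b)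
  refine ⟨M.1 0 0, Matrix.ext fun a b => ?_⟩
  by_cases hab : a = b
  · subst hab
    by_cases ha : a = 0
    · subst ha; simp
    have h4 := congrArg (MvPolynomial.eval 1) (h2 a 0)
    simp only [map_mul, map_sum, eval_C, eval_X, Pi.one_apply, mul_one, one_mul] at h4
    rw [Finset.sum_eq_single a (fun j _ hj => h3 a j hj.symm) (by simp),
      Finset.sum_eq_single 0 (fun j _ hj => h3 0 j hj.symm) (by simp)] at h4
    simp [h4]
  · simp [h3 a b hab, hab]

theorem exists_smul_of_projLinear_eq {A B : GL (Fin (n + 1)) K}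
    (h : projLinear A = projLinear B) : ∃ c : K, A.1 = c • B.1 := by
  have h1 : projLinear (B⁻¹ * A) = 𝟙 _ := by
    rw [← projLinear_comp, h, projLinear_comp, inv_mul_cancel, projLinear_one]
  obtain ⟨c, hc⟩ := exists_smul_one_of_projLinear_eq_id h1
  refine ⟨c, ?_⟩
  have h2 : A = B * (B⁻¹ * A) := by group
  rw [h2, Units.val_mul, hc, mul_smul_comm, mul_one]

end Linear

/-! ### Galois descent of morphisms -/

section GaloisDescent

/-- An explicit form of the splitting of `L ⊗ L` into copies of `L` indexed by the Galois group. For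
a primitive element `θ`, the polynomial `∏ (T - g θ)` has coefficients in `k`, so `∏ (u₂ θ - u₁ (g
θ)) = 0`. Take `s g` to be the product without the factor of `g`: where it is invertible, `u₂ θ = u₁
(g θ)`. Two factors differ by the image of a nonzero element of `L`, so no maximal ideal contains
all the `s g`. -/
theorem exists_span_range_eq_top_of_isGalois {k L : Type*} [Field k] [Field L] [Algebra k L]
    [FiniteDimensional k L] [IsGalois k L] {R : Type*} [CommRing R] (u₁ u₂ : L →+* R)
    (h : ∀ c : k, u₁ (algebraMap k L c) = u₂ (algebraMap k L c)) :
    ∃ s : (L ≃ₐ[k] L) → R, Ideal.span (Set.range s) = ⊤ ∧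
      ∀ (g : L ≃ₐ[k] L) {B : Type _} [CommRing B] (ρ : R →+* B), IsUnit (ρ (s g)) →
        ρ.comp u₂ = (ρ.comp u₁).comp (g : L →+* L) := by
  classical
  let pb := Field.powerBasisOfFiniteOfSeparable k L
  let F := MulSemiringAction.charpoly (L ≃ₐ[k] L) pb.gen
  have hF : F.map u₁ = F.map u₂ := by
    ext i
    rw [Polynomial.coeff_map, Polynomial.coeff_map]
    obtain ⟨c, hc⟩ := (IsGalois.mem_bot_iff_fixed (F := k) (F.coeff i)).2 fun g =>
      MulSemiringAction.smul_coeff_charpoly _ _ g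
    rw [← hc]
    exact h c
  have hprod : ∏ g : L ≃ₐ[k] L, (u₂ pb.gen - u₁ (g pb.gen)) = 0 := by
    have h1 : F.eval₂ u₂ (u₂ pb.gen) = 0 := by
      rw [Polynomial.eval₂_at_apply, MulSemiringAction.eval_charpoly, map_zero]
    rw [← Polynomial.eval_map, ← hF, Polynomial.eval_map] at h1
    rw [← h1]
    simp only [F, MulSemiringAction.charpoly_eq, Polynomial.eval₂_finsetProd]
    simp
  refine ⟨fun g => ∏ h ∈ Finset.univ.erase g, (u₂ pb.gen - u₁ (h pb.gen)), ?_, fun g B _ ρ hu => ?_⟩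
  · by_contra hne
    obtain ⟨m, hm, hle⟩ := Ideal.exists_le_maximal _ hne
    have hmp := hm.isPrime
    obtain ⟨g, -, hg⟩ := (Ideal.IsPrime.prod_mem_iff (s := Finset.univ)
      (x := fun g : L ≃ₐ[k] L => u₂ pb.gen - u₁ (g pb.gen))).1 (hprod ▸ m.zero_mem)
    obtain ⟨h', hh, hh'⟩ := Ideal.IsPrime.prod_mem_iff.1 (hle (Ideal.subset_span ⟨g, rfl⟩))
    have h1 : u₁ (g pb.gen - h' pb.gen) ∈ m := by
      have := m.sub_mem hh' hg
      rwa [sub_sub_sub_cancel_left, ← map_sub] at this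
    refine hmp.ne_top (Ideal.eq_top_of_isUnit_mem _ h1 ((IsUnit.mk0 _ ?_).map u₁))
    intro h0
    refine (Finset.mem_erase.1 hh).1 (AlgEquiv.coe_toAlgHom_injective (pb.algHom_ext ?_))
    exact (sub_eq_zero.1 h0).symm
  · have h1 : ρ (u₂ pb.gen) = ρ (u₁ (g pb.gen)) := by
      rw [← sub_eq_zero, ← map_sub]
      refine (hu.mul_right_eq_zero).1 ?_
      rw [← map_mul, Finset.prod_erase_mul _ _ (Finset.mem_univ g), hprod, map_zero]
    ext x
    have hx : x ∈ Algebra.adjoin k {pb.gen} := pb.adjoin_gen_eq_top ▸ Algebra.mem_top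
    induction hx using Algebra.adjoin_induction with
    | mem x hx => rw [Set.mem_singleton_iff.1 hx]; exact h1
    | algebraMap r => simp [h]
    | add x y _ _ hx hy => rw [map_add, map_add, hx, hy]
    | mul x y _ _ hx hy => rw [map_mul, map_mul, hx, hy]

theorem hom_ext_of_span_eq_top {R : Type u} [CommRing R] {W : Scheme.{u}} {ι : Type u} (s : ι → R)
    (hs : Ideal.span (Set.range s) = ⊤) (f g : Spec (CommRingCat.of R) ⟶ W)
    (h : ∀ i, Spec.map (CommRingCat.ofHom (algebraMap R (Localization.Away (s i)))) ≫ f =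
      Spec.map (CommRingCat.ofHom (algebraMap R (Localization.Away (s i)))) ≫ g) : f = g :=
  Scheme.Cover.hom_ext (Scheme.affineOpenCoverOfSpanRangeEqTop (R := .of R) s hs).openCover f g h

variable {k L : Type u} [Field k] [Field L] [Algebra k L] {P S W : Scheme.{u}} {q : P ⟶ Spec (CommRingCat.of L)} {r : S ⟶ Spec (CommRingCat.of k)}
  {p : P ⟶ S}

/-- The projection is flat, surjective and quasi-compact, as a base change of the spectrum of a
field extension. -/
theorem effectiveEpi_of_isPullback
    (hp : IsPullback p q r (Spec.map (CommRingCat.ofHom (algebraMap k L)))) : EffectiveEpi p := by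
  have : Flat (Spec.map (CommRingCat.ofHom (algebraMap k L))) := by
    rw [Flat.SpecMap_iff]
    exact (RingHom.flat_algebraMap_iff).2 inferInstance
  have : Surjective (Spec.map (CommRingCat.ofHom (algebraMap k L))) :=
    ⟨Function.surjective_to_subsingleton (α := PrimeSpectrum L) (β := PrimeSpectrum k) _⟩
  have : Flat p := MorphismProperty.of_isPullback hp.flip inferInstance
  have : Surjective p := MorphismProperty.of_isPullback hp.flip inferInstance
  have : QuasiCompact p := MorphismProperty.of_isPullback hp.flip inferInstance
  infer_instance

variable [FiniteDimensional k L] [IsGalois k L]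

theorem spec_comp_eq_comp_of_galois_invariant
    (hp : IsPullback p q r (Spec.map (CommRingCat.ofHom (algebraMap k L))))
    (σ : (L ≃ₐ[k] L) → (P ⟶ P)) (hσp : ∀ g, σ g ≫ p = p)
    (hσq : ∀ g, σ g ≫ q = q ≫ Spec.map (CommRingCat.ofHom (g : L →+* L)))
    {e : P ⟶ W} (he : ∀ g, σ g ≫ e = e) {R : Type u} [CommRing R]
    (g₁ g₂ : Spec (CommRingCat.of R) ⟶ P) (h : g₁ ≫ p = g₂ ≫ p) : g₁ ≫ e = g₂ ≫ e := by
  obtain ⟨u₁, hu₁⟩ := Spec.map_surjective (g₁ ≫ q)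
  obtain ⟨u₂, hu₂⟩ := Spec.map_surjective (g₂ ≫ q)
  have hu : ∀ c : k, u₁.hom (algebraMap k L c) = u₂.hom (algebraMap k L c) := fun c => by
    have h1 : CommRingCat.ofHom (algebraMap k L) ≫ u₁ = CommRingCat.ofHom (algebraMap k L) ≫ u₂ := by
      apply Spec.map_injective
      rw [Spec.map_comp, Spec.map_comp, hu₁, hu₂, Category.assoc, Category.assoc, ← hp.w,
        ← Category.assoc, h, Category.assoc]
    exact DFunLike.congr_fun (congrArg CommRingCat.Hom.hom h1) c
  obtain ⟨s, hs, hsg⟩ := exists_span_range_eq_top_of_isGalois (k := k) (L := L) (R := R)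
    u₁.hom u₂.hom hu
  refine hom_ext_of_span_eq_top s hs _ _ fun g => ?_
  have h1 := hsg g (algebraMap R (Localization.Away (s g)))
    (IsLocalization.Away.algebraMap_isUnit (s g))
  have h2 : u₂ ≫ CommRingCat.ofHom (algebraMap R (Localization.Away (s g))) =
      CommRingCat.ofHom (g : L →+* L) ≫ u₁ ≫
        CommRingCat.ofHom (algebraMap R (Localization.Away (s g))) :=
    CommRingCat.hom_ext h1
  generalize CommRingCat.ofHom (algebraMap R (Localization.Away (s g))) = t at h2
  -- Where `s g` is invertible, the two points over `S` differ exactly by the Galois element `g`,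
  -- and `e` does not see `σ g`.
  have h3 : Spec.map t ≫ g₂ = Spec.map t ≫ g₁ ≫ σ g := by
    refine hp.hom_ext ?_ ?_
    · rw [Category.assoc, Category.assoc, Category.assoc, hσp, h]
    · rw [Category.assoc, Category.assoc, Category.assoc, hσq, ← Category.assoc g₁, ← hu₁, ← hu₂,
        ← Spec.map_comp, h2, Spec.map_comp, Spec.map_comp, Category.assoc]
  rw [← Category.assoc _ g₂, h3, Category.assoc, Category.assoc, he]

/-- Galois descent of morphisms: a morphism on `S ×_k L` which is invariant under the Galois group
coequalizes any two morphisms which agree over `S`. -/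
theorem comp_eq_comp_of_galois_invariant
    (hp : IsPullback p q r (Spec.map (CommRingCat.ofHom (algebraMap k L))))
    (σ : (L ≃ₐ[k] L) → (P ⟶ P)) (hσp : ∀ g, σ g ≫ p = p)
    (hσq : ∀ g, σ g ≫ q = q ≫ Spec.map (CommRingCat.ofHom (g : L →+* L)))
    {e : P ⟶ W} (he : ∀ g, σ g ≫ e = e) {Z : Scheme.{u}} (g₁ g₂ : Z ⟶ P)
    (h : g₁ ≫ p = g₂ ≫ p) : g₁ ≫ e = g₂ ≫ e := by
  refine Scheme.Cover.hom_ext Z.affineOpenCover.openCover _ _ fun i => ?_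
  rw [← Category.assoc, ← Category.assoc]
  exact spec_comp_eq_comp_of_galois_invariant hp σ hσp hσq he
    (Z.affineOpenCover.f i ≫ g₁) (Z.affineOpenCover.f i ≫ g₂)
    ((Category.assoc _ _ _).trans ((congrArg (_ ≫ ·) h).trans (Category.assoc _ _ _).symm))

/-- Galois descent of morphisms. -/
theorem exists_descent_of_galois_invariant
    (hp : IsPullback p q r (Spec.map (CommRingCat.ofHom (algebraMap k L))))
    (σ : (L ≃ₐ[k] L) → (P ⟶ P)) (hσp : ∀ g, σ g ≫ p = p)
    (hσq : ∀ g, σ g ≫ q = q ≫ Spec.map (CommRingCat.ofHom (g : L →+* L)))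
    {e : P ⟶ W} (he : ∀ g, σ g ≫ e = e) : ∃ α : S ⟶ W, p ≫ α = e := by
  have := effectiveEpi_of_isPullback hp
  exact ⟨EffectiveEpi.desc p e fun g₁ g₂ h =>
    comp_eq_comp_of_galois_invariant hp σ hσp hσq he g₁ g₂ h, EffectiveEpi.fac _ _ _⟩

end GaloisDescent

/-! ### Splittings of a form of projective space and their twists -/

section Splitting

variable {n : ℕ} {k L L' : Type u} [Field k] [Field L] [Field L'] [Algebra k L] [Algebra k L']
  {S : Over (Spec (CommRingCat.of k))}

/-- A morphism `p : ℙⁿ_L ⟶ S` that identifies `ℙⁿ_L` with the base change `S ×_k L`. -/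
def IsSplitting (S : Over (Spec (CommRingCat.of k))) (p : (projSpace n L).left ⟶ S.left) : Prop :=
  IsPullback p (projSpace n L).hom S.hom (Spec.map (CommRingCat.ofHom (algebraMap k L)))

/-- The matrices `a g` describe the action of `Gal(L/k)` on `ℙⁿ_L ≅ S_L`. -/
def IsTwistOf (a : (L ≃ₐ[k] L) → GL (Fin (n + 1)) L) (p : (projSpace n L).left ⟶ S.left) : Prop :=
  ∀ g : L ≃ₐ[k] L, projGalois n g ≫ projLinear (a g) ≫ p = p

theorem smul_conj_eq {K : Type*} [Field K] {m : ℕ} {A B : GL (Fin m) K} {c : K}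
    (h : A.1 = c • B.1) (M : GL (Fin m) K) : A * M * A⁻¹ = B * M * B⁻¹ := by
  rw [mul_inv_eq_iff_eq_mul]
  apply Units.ext
  have h1 : B.1 * M.1 * B⁻¹.1 * B.1 = B.1 * M.1 := by
    rw [mul_assoc (B.1 * M.1), Units.inv_mul, mul_one]
  simp only [Units.val_mul, h, smul_mul_assoc, mul_smul_comm, h1]

theorem conj_eq_of_projLinear_eq {A B : GL (Fin (n + 1)) L} (h : projLinear A = projLinear B)
    (M : GL (Fin (n + 1)) L) : A * M * A⁻¹ = B * M * B⁻¹ := by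
  obtain ⟨c, hc⟩ := exists_smul_of_projLinear_eq h
  exact smul_conj_eq hc M

theorem projGalois_hom (g : L ≃ₐ[k] L) : projGalois n g ≫ (projSpace n L).hom =
    (projSpace n L).hom ≫ Spec.map (CommRingCat.ofHom ((g⁻¹ : L ≃ₐ[k] L) : L →+* L)) :=
  projExt_hom _

theorem projGalois_comp_inv (g : L ≃ₐ[k] L) : projGalois n g ≫ projGalois n g⁻¹ = 𝟙 _ := by
  rw [projGalois_eq_projExt, projGalois_eq_projExt, projExt_comp]
  refine Eq.trans (congrArg _ ?_) projExt_id
  ext x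
  exact g.symm_apply_apply x

theorem projGalois_inv_comp (g : L ≃ₐ[k] L) : projGalois n g⁻¹ ≫ projGalois n g = 𝟙 _ := by
  have h := projGalois_comp_inv (n := n) g⁻¹
  rwa [inv_inv] at h

instance (g : L ≃ₐ[k] L) : IsIso (projGalois n g) :=
  ⟨projGalois n g⁻¹, projGalois_comp_inv g, projGalois_inv_comp g⟩

theorem projLinear_projGalois (g : L ≃ₐ[k] L) (M : GL (Fin (n + 1)) L) :
    projLinear M ≫ projGalois n g =
      projGalois n g ≫ projLinear (Matrix.GeneralLinearGroup.map (g : L →+* L) M) := by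
  have h := projLinear_projExt ((g⁻¹ : L ≃ₐ[k] L) : L →+* L)
    (Matrix.GeneralLinearGroup.map (g : L →+* L) M)
  have h2 : Matrix.GeneralLinearGroup.map ((g⁻¹ : L ≃ₐ[k] L) : L →+* L)
      (Matrix.GeneralLinearGroup.map (g : L →+* L) M) = M := by
    ext i j
    exact g.symm_apply_apply _
  rw [h2] at h
  exact h

namespace IsSplitting

variable {p p' : (projSpace n L).left ⟶ S.left}

theorem hom_ext (hp : IsSplitting S p) {Z : Scheme.{u}} {f g : Z ⟶ (projSpace n L).left}
    (h : f ≫ p = g ≫ p) (h' : f ≫ (projSpace n L).hom = g ≫ (projSpace n L).hom) : f = g :=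
  IsPullback.hom_ext hp h h'

theorem projLinear_ext (hp : IsSplitting S p) {A B : GL (Fin (n + 1)) L}
    (h : projLinear A ≫ p = projLinear B ≫ p) : projLinear A = projLinear B :=
  hp.hom_ext h (by rw [projLinear_hom, projLinear_hom])

theorem comp_projExt [Algebra L L'] [IsScalarTower k L L'] (hp : IsSplitting S p) :
    IsSplitting S (projExt n (algebraMap L L') ≫ p) := by
  have h := (isPullback_projExt (n := n) (algebraMap L L')).paste_horiz hp
  rw [← Spec.map_comp, ← CommRingCat.ofHom_comp, ← IsScalarTower.algebraMap_eq] at h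
  exact h

/-- Two pullbacks of the same diagram are canonically isomorphic, and this isomorphism is an
automorphism of projective space over `L`, hence linear. -/
theorem exists_projLinear_comp_eq [Nontrivial (Fin (n + 1))] (hp : IsSplitting S p)
    (hp' : IsSplitting S p') : ∃ N : GL (Fin (n + 1)) L, projLinear N ≫ p' = p := by
  let e := IsPullback.isoIsPullback _ _ hp hp'
  have h1 : e.hom ≫ p' = p := IsPullback.isoIsPullback_hom_fst _ _ hp hp'
  have h2 : e.hom ≫ (projSpace n L).hom = (projSpace n L).hom :=
    IsPullback.isoIsPullback_hom_snd _ _ hp hp'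
  have h3 : e.inv ≫ (projSpace n L).hom = (projSpace n L).hom :=
    IsPullback.isoIsPullback_inv_snd _ _ hp hp'
  obtain ⟨N, hN⟩ := exists_eq_projLinear e.hom e.inv h2 h3 e.hom_inv_id
  exact ⟨N, hN ▸ h1⟩

end IsSplitting

theorem isTwistOf_comp_projExt [Algebra L L'] {p : (projSpace n L).left ⟶ S.left}
    {a : (L ≃ₐ[k] L) → GL (Fin (n + 1)) L} (ha : IsTwistOf a p) (ρ : (L' ≃ₐ[k] L') → (L ≃ₐ[k] L))
    (hρ : ∀ g x, algebraMap L L' (ρ g x) = g (algebraMap L L' x)) :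
    IsTwistOf (fun g => Matrix.GeneralLinearGroup.map (algebraMap L L') (a (ρ g)))
      (projExt n (algebraMap L L') ≫ p) := by
  intro g
  have h : projGalois n g ≫ projExt n (algebraMap L L') =
      projExt n (algebraMap L L') ≫ projGalois n (ρ g) := by
    rw [projGalois_eq_projExt, projGalois_eq_projExt, projExt_comp, projExt_comp]
    congr 1
    ext x
    change g.symm (algebraMap L L' x) = algebraMap L L' ((ρ g).symm x)
    rw [AlgEquiv.symm_apply_eq, ← hρ, AlgEquiv.apply_symm_apply]
  rw [← Category.assoc (projLinear _), projLinear_projExt, Category.assoc, ← Category.assoc, h,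
    Category.assoc, ha]

/-- The two twists are cohomologous through `N`: the matrices `N * a g` and `a' g * N^g` induce the
same automorphism, so they differ by a scalar, which disappears under conjugation. Thus conjugation
by `N` carries compatible matrices to compatible matrices. -/
theorem conj_map_eq {p p' : (projSpace n L).left ⟶ S.left} (hp' : IsSplitting S p')
    {a a' : (L ≃ₐ[k] L) → GL (Fin (n + 1)) L} (ha : IsTwistOf a p) (ha' : IsTwistOf a' p')
    {N A : GL (Fin (n + 1)) L} (hN : projLinear N ≫ p' = p) {g : L ≃ₐ[k] L}
    (hA : Matrix.GeneralLinearGroup.map (g : L →+* L) A = (a g)⁻¹ * A * a g) :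
    Matrix.GeneralLinearGroup.map (g : L →+* L) (N * A * N⁻¹) =
      (a' g)⁻¹ * (N * A * N⁻¹) * a' g := by
  have h1 : projLinear (N * a g) =
      projLinear (a' g * Matrix.GeneralLinearGroup.map (g : L →+* L) N) := by
    refine hp'.projLinear_ext ?_
    rw [← cancel_epi (projGalois n g), ← projLinear_comp, ← projLinear_comp, Category.assoc,
      Category.assoc, hN, ha, ← Category.assoc, ← projLinear_projGalois, Category.assoc, ha', hN]
  have h2 := conj_eq_of_projLinear_eq h1 ((a g)⁻¹ * A * a g)
  simp only [map_mul, map_inv, hA]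
  have h3 : N * a g * ((a g)⁻¹ * A * a g) * (N * a g)⁻¹ = N * A * N⁻¹ := by group
  rw [h3] at h2
  rw [h2]
  group

/-- A matrix which is compatible with the Galois action descends to an endomorphism of `S`. -/
theorem exists_descent [FiniteDimensional k L] [IsGalois k L]
    {p : (projSpace n L).left ⟶ S.left} (hp : IsSplitting S p)
    {a : (L ≃ₐ[k] L) → GL (Fin (n + 1)) L} (ha : IsTwistOf a p) {M : GL (Fin (n + 1)) L}
    (hM : ∀ g : L ≃ₐ[k] L,
      Matrix.GeneralLinearGroup.map (g : L →+* L) M = (a g)⁻¹ * M * a g) :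
    ∃ α : S.left ⟶ S.left, p ≫ α = projLinear M ≫ p := by
  refine exists_descent_of_galois_invariant hp
    -- The inverse appears because `projGalois n g` lies over `Spec (g⁻¹)`, while the descent
    -- statement expects an action over `Spec g`.
    (fun g => projGalois n g⁻¹ ≫ projLinear (a g⁻¹)) (fun g => ?_) (fun g => ?_) fun g => ?_
  · rw [Category.assoc, ha]
  · rw [Category.assoc, projLinear_hom, projGalois_hom, inv_inv]
  · rw [← Category.assoc, Category.assoc (projGalois n g⁻¹), projLinear_comp,
      show M * a g⁻¹ = a g⁻¹ * Matrix.GeneralLinearGroup.map ((g⁻¹ : L ≃ₐ[k] L) : L →+* L) M by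
        rw [hM]; group,
      ← projLinear_comp, ← Category.assoc, ← projLinear_projGalois, Category.assoc, Category.assoc,
      ha]

/-- `M` and `M⁻¹` are both compatible, so both descend. As `p` is an epimorphism, the descended
morphisms are inverse to each other and lie over `k`. -/
theorem exists_aut [FiniteDimensional k L] [IsGalois k L]
    {p : (projSpace n L).left ⟶ S.left} (hp : IsSplitting S p)
    {a : (L ≃ₐ[k] L) → GL (Fin (n + 1)) L} (ha : IsTwistOf a p) {M : GL (Fin (n + 1)) L}
    (hM : ∀ g : L ≃ₐ[k] L,
      Matrix.GeneralLinearGroup.map (g : L →+* L) M = (a g)⁻¹ * M * a g) :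
    ∃ α : Aut S, projLinear M ≫ p = p ≫ α.hom.left := by
  have : EffectiveEpi p := effectiveEpi_of_isPullback hp
  have hM' : ∀ g : L ≃ₐ[k] L,
      Matrix.GeneralLinearGroup.map (g : L →+* L) M⁻¹ = (a g)⁻¹ * M⁻¹ * a g := fun g => by
    rw [map_inv, hM]; group
  obtain ⟨α, hα⟩ := exists_descent hp ha hM
  obtain ⟨β, hβ⟩ := exists_descent hp ha hM'
  have hw : p ≫ S.hom = (projSpace n L).hom ≫ Spec.map (CommRingCat.ofHom (algebraMap k L)) :=
    hp.w
  have hover : ∀ {γ : S.left ⟶ S.left} {N : GL (Fin (n + 1)) L}, p ≫ γ = projLinear N ≫ p →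
      γ ≫ S.hom = S.hom := fun {γ N} h => by
    rw [← cancel_epi p, ← Category.assoc, h, Category.assoc, hw, ← Category.assoc, projLinear_hom]
  have hαβ : α ≫ β = 𝟙 _ := by
    rw [← cancel_epi p, ← Category.assoc, hα, Category.assoc, hβ, ← Category.assoc,
      projLinear_comp_inv, Category.id_comp, Category.comp_id]
  have hβα : β ≫ α = 𝟙 _ := by
    rw [← cancel_epi p, ← Category.assoc, hβ, Category.assoc, hα, ← Category.assoc,
      projLinear_inv_comp, Category.id_comp, Category.comp_id]
  exact ⟨Over.isoMk ⟨α, β, hαβ, hβα⟩ (hover hα), hα.symm⟩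

/-- The splitting that corresponds to an isomorphism `S_L ≅ ℙⁿ_L`. -/
def splittingOf (φ : (baseChange k L).obj S ≅ projSpace n L) : (projSpace n L).left ⟶ S.left :=
  φ.inv.left ≫ pullback.fst S.hom (Spec.map (CommRingCat.ofHom (algebraMap k L)))

theorem isSplitting_splittingOf (φ : (baseChange k L).obj S ≅ projSpace n L) :
    IsSplitting S (splittingOf φ) := by
  refine IsPullback.of_iso (IsPullback.of_hasPullback S.hom
    (Spec.map (CommRingCat.ofHom (algebraMap k L)))) ((Over.forget _).mapIso φ) (Iso.refl _)
    (Iso.refl _) (Iso.refl _) ?_ ?_ ?_ ?_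
  · rw [splittingOf, Iso.refl_hom, Category.comp_id]
    exact (Iso.hom_inv_id_assoc ((Over.forget _).mapIso φ) _).symm
  · exact (Category.comp_id _).trans (Over.w φ.hom).symm
  · rw [Iso.refl_hom, Iso.refl_hom, Category.comp_id, Category.id_comp]
  · rw [Iso.refl_hom, Iso.refl_hom, Category.comp_id, Category.id_comp]

theorem isTwistOf_of_isCocycleOf {φ : (baseChange k L).obj S ≅ projSpace 2 L}
    {a : (L ≃ₐ[k] L) → GL (Fin 3) L} (h : IsCocycleOf φ a) : IsTwistOf a (splittingOf φ) := by
  intro g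
  have h1 : φ.hom.left ≫ φ.inv.left = 𝟙 _ := ((Over.forget _).mapIso φ).hom_inv_id
  rw [← Category.assoc, ← h g, splittingOf, Category.assoc, Category.assoc,
    ← Category.assoc φ.hom.left, h1, Category.id_comp]
  congr 1
  exact (pullback.lift_fst _ _ _).trans (Category.comp_id _)

theorem left_eq_projLinear_iff {φ : (baseChange k L).obj S ≅ projSpace 2 L} {α : Aut S}
    {A : GL (Fin 3) L} : (φ.inv ≫ (baseChange k L).map α.hom ≫ φ.hom).left = projLinear A ↔
      projLinear A ≫ splittingOf φ = splittingOf φ ≫ α.hom.left := by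
  have h1 : φ.hom.left ≫ φ.inv.left = 𝟙 _ := ((Over.forget _).mapIso φ).hom_inv_id
  have h2 : (φ.inv ≫ (baseChange k L).map α.hom ≫ φ.hom).left ≫ splittingOf φ =
      splittingOf φ ≫ α.hom.left := by
    rw [Over.comp_left, Over.comp_left, splittingOf, Category.assoc, Category.assoc,
      ← Category.assoc φ.hom.left, h1, Category.id_comp, Category.assoc]
    congr 1
    exact pullback.lift_fst _ _ _
  refine ⟨fun h => h ▸ h2, fun h => (isSplitting_splittingOf φ).hom_ext (h2.trans h.symm) ?_⟩
  exact (Over.w _).trans (projLinear_hom A).symm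

end Splitting

/-! ### Reduced norms, invariants and composita -/

section Algebra

/-- Skolem–Noether: an automorphism of the endomorphism algebra of a vector space is conjugation by
a linear automorphism. -/
theorem det_algEquiv_apply {K : Type*} [Field K] {m : Type*} [Fintype m] [DecidableEq m]
    (e : Matrix m m K ≃ₐ[K] Matrix m m K) (M : Matrix m m K) : (e M).det = M.det := by
  obtain ⟨T, hT⟩ := AlgEquiv.eq_linearEquivConjAlgEquiv
    ((Matrix.toLinAlgEquiv'.symm.trans e).trans Matrix.toLinAlgEquiv')
  have h := DFunLike.congr_fun hT (Matrix.toLinAlgEquiv' M)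
  rw [AlgEquiv.trans_apply, AlgEquiv.trans_apply, AlgEquiv.symm_apply_apply] at h
  have h2 := congrArg LinearMap.det h
  rw [LinearEquiv.conjAlgEquiv_apply] at h2
  have h3 := LinearMap.det_conj (Matrix.toLinAlgEquiv' M) T
  have h4 : ∀ N : Matrix m m K, LinearMap.det (Matrix.toLinAlgEquiv' N) = N.det := fun N =>
    LinearMap.det_toLin' N
  rw [← h4, ← h4 M, h2, ← h3]

/-- The determinant of a splitting representation of a central simple algebra does not depend on
the representation. -/
theorem det_eq_of_span_range_eq_top {k L A m : Type*} [Field k] [Field L] [Algebra k L] [Ring A]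
    [Algebra k A] [Fintype m] [DecidableEq m] [FiniteDimensional k A]
    (hA : Module.finrank k A = Fintype.card m * Fintype.card m)
    (F G : A →ₐ[k] Matrix m m L) (hF : Submodule.span L (Set.range F) = ⊤)
    (hG : Submodule.span L (Set.range G) = ⊤) (x : A) : (F x).det = (G x).det := by
  -- A representation whose image spans extends to a surjection from `L ⊗ A`, which is bijective
  -- since the dimensions agree. Two such isomorphisms differ by an automorphism of the matrix
  -- algebra.
  have key : ∀ H : A →ₐ[k] Matrix m m L, Submodule.span L (Set.range H) = ⊤ →
      ∃ e : (L ⊗[k] A) ≃ₐ[L] Matrix m m L, ∀ x, e (1 ⊗ₜ x) = H x := fun H hH => by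
    let Φ : (L ⊗[k] A) →ₐ[L] Matrix m m L := Algebra.TensorProduct.lift (Algebra.ofId _ _) H
      fun a b => Algebra.commutes a _
    have hΦ : ∀ x, Φ (1 ⊗ₜ x) = H x := fun x => by
      refine (Algebra.TensorProduct.lift_tmul _ _ _ _ _).trans ?_
      rw [map_one, one_mul]
    have hs : Function.Surjective Φ.toLinearMap := by
      rw [← LinearMap.range_eq_top, ← top_le_iff, ← hH, Submodule.span_le]
      rintro _ ⟨x, rfl⟩
      exact ⟨1 ⊗ₜ x, hΦ x⟩
    have hd : Module.finrank L (L ⊗[k] A) = Module.finrank L (Matrix m m L) := by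
      rw [Module.finrank_baseChange, hA, Module.finrank_matrix, Module.finrank_self, mul_one]
    exact ⟨AlgEquiv.ofBijective Φ
      ⟨(LinearMap.injective_iff_surjective_of_finrank_eq_finrank hd).2 hs, hs⟩, hΦ⟩
  obtain ⟨e, he⟩ := key F hF
  obtain ⟨e', he'⟩ := key G hG
  have h := det_algEquiv_apply (e.symm.trans e') (F x)
  rw [← he, AlgEquiv.trans_apply, AlgEquiv.symm_apply_apply, he'] at h
  rw [h, he]

theorem span_range_map_eq_top {L L' m ι : Type*} [Field L] [Field L'] [Algebra L L'] [Fintype m]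
    [DecidableEq m] {F : ι → Matrix m m L} (hF : Submodule.span L (Set.range F) = ⊤) :
    Submodule.span L' (Set.range fun i => (F i).map (algebraMap L L')) = ⊤ := by
  have h : ∀ M : Matrix m m L, M.map (algebraMap L L') ∈
      Submodule.span L' (Set.range fun i => (F i).map (algebraMap L L')) := fun M => by
    have hM : M ∈ Submodule.span L (Set.range F) := hF ▸ Submodule.mem_top
    induction hM using Submodule.span_induction with
    | mem x hx =>
      obtain ⟨i, rfl⟩ := hx
      exact Submodule.subset_span ⟨i, rfl⟩
    | zero => rw [Matrix.map_zero _ (map_zero _)]; exact Submodule.zero_mem _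
    | add x y _ _ hx hy =>
      rw [Matrix.map_add _ (map_add _)]
      exact Submodule.add_mem _ hx hy
    | smul a x _ hx =>
      rw [show (a • x).map (algebraMap L L') = algebraMap L L' a • x.map (algebraMap L L') by
        ext; simp]
      exact Submodule.smul_mem _ _ hx
  rw [eq_top_iff]
  rintro M -
  rw [Matrix.matrix_eq_sum_single M]
  refine Submodule.sum_mem _ fun i _ => Submodule.sum_mem _ fun j _ => ?_
  have h1 := Submodule.smul_mem _ (M i j) (h (Matrix.single i j 1))
  rwa [Matrix.map_single, map_one, Matrix.smul_single, smul_eq_mul, mul_one] at h1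

theorem span_range_one_tmul_eq_top {k L A m : Type*} [Field k] [Field L] [Algebra k L] [Ring A]
    [Algebra k A] [Fintype m] [DecidableEq m] (f : (L ⊗[k] A) ≃ₐ[L] Matrix m m L) :
    Submodule.span L (Set.range fun x : A => f (1 ⊗ₜ x)) = ⊤ := by
  rw [eq_top_iff]
  rintro M -
  obtain ⟨y, rfl⟩ := f.surjective M
  induction y using TensorProduct.induction_on with
  | zero => rw [map_zero]; exact Submodule.zero_mem _
  | add x y hx hy => rw [map_add]; exact Submodule.add_mem _ hx hy
  | tmul a x =>
    rw [← mul_one a, ← smul_eq_mul, ← TensorProduct.smul_tmul', map_smul]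
    exact Submodule.smul_mem _ _ (Submodule.subset_span ⟨x, rfl⟩)

/-- Galois invariant elements of `L ⊗ A` come from `A`. -/
theorem exists_eq_one_tmul_of_forall_map_eq {k L A : Type*} [Field k] [Field L] [Algebra k L]
    [FiniteDimensional k L] [IsGalois k L] [Ring A] [Algebra k A] [FiniteDimensional k A]
    {y : L ⊗[k] A} (hy : ∀ g : L ≃ₐ[k] L,
      Algebra.TensorProduct.map (g : L →ₐ[k] L) (AlgHom.id k A) y = y) : ∃ x : A, y = 1 ⊗ₜ x := by
  let b := Module.finBasis k A
  let B := Algebra.TensorProduct.basis L b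
  -- In a basis coming from `A`, the group acts on the coordinates one by one, so an invariant
  -- tensor has its coordinates in `k`.
  have h : ∀ (g : L ≃ₐ[k] L) (z : L ⊗[k] A) i, B.repr
      (Algebra.TensorProduct.map (g : L →ₐ[k] L) (AlgHom.id k A) z) i = g (B.repr z i) :=
    fun g z i => by
    induction z using TensorProduct.induction_on with
    | zero => simp
    | add x y hx hy => simp only [map_add, Finsupp.add_apply, hx, hy]
    | tmul a x => simp [B, Algebra.TensorProduct.basis_repr_tmul]
  have h2 : ∀ i, ∃ c : k, algebraMap k L c = B.repr y i := fun i =>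
    (IsGalois.mem_bot_iff_fixed (F := k) (B.repr y i)).2 fun g => by rw [← h, hy]
  choose c hc using h2
  refine ⟨∑ i, c i • b i, ?_⟩
  rw [← B.sum_repr y, TensorProduct.tmul_sum]
  refine Finset.sum_congr rfl fun i _ => ?_
  rw [← hc, Algebra.TensorProduct.basis_apply, algebraMap_smul, TensorProduct.tmul_smul]

theorem exists_compositum {k L₀ L₁ : Type u} [Field k] [Field L₀] [Field L₁] [Algebra k L₀]
    [Algebra k L₁] [FiniteDimensional k L₀] [FiniteDimensional k L₁] [IsGalois k L₀]
    [IsGalois k L₁] : ∃ (L : Type u) (_ : Field L) (_ : Algebra k L) (_ : FiniteDimensional k L)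
      (_ : IsGalois k L) (_ : Algebra L₀ L) (_ : Algebra L₁ L),
      IsScalarTower k L₀ L ∧ IsScalarTower k L₁ L := by
  let i₀ : L₀ →ₐ[k] AlgebraicClosure k := IsAlgClosed.lift
  let i₁ : L₁ →ₐ[k] AlgebraicClosure k := IsAlgClosed.lift
  have : IsGalois k i₀.fieldRange := IsGalois.of_algEquiv (AlgEquiv.ofInjectiveField i₀)
  have : IsGalois k i₁.fieldRange := IsGalois.of_algEquiv (AlgEquiv.ofInjectiveField i₁)
  have : FiniteDimensional k i₀.fieldRange :=
    (AlgEquiv.ofInjectiveField i₀).toLinearEquiv.finiteDimensional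
  have : FiniteDimensional k i₁.fieldRange :=
    (AlgEquiv.ofInjectiveField i₁).toLinearEquiv.finiteDimensional
  let j₀ : L₀ →ₐ[k] (i₀.fieldRange ⊔ i₁.fieldRange : IntermediateField k (AlgebraicClosure k)) :=
    (IntermediateField.inclusion le_sup_left).comp i₀.rangeRestrict
  let j₁ : L₁ →ₐ[k] (i₀.fieldRange ⊔ i₁.fieldRange : IntermediateField k (AlgebraicClosure k)) :=
    (IntermediateField.inclusion le_sup_right).comp i₁.rangeRestrict
  refine ⟨(i₀.fieldRange ⊔ i₁.fieldRange : IntermediateField k (AlgebraicClosure k)),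
    inferInstance, inferInstance, inferInstance, IsGalois.mk, j₀.toRingHom.toAlgebra,
    j₁.toRingHom.toAlgebra, ?_, ?_⟩
  · exact @IsScalarTower.of_algebraMap_eq _ _ _ _ _ _ _ (_) (_) fun x => (j₀.commutes x).symm
  · exact @IsScalarTower.of_algebraMap_eq _ _ _ _ _ _ _ (_) (_) fun x => (j₁.commutes x).symm

end Algebra

/-! ### Determinants of automorphisms as reduced norms -/

section Determinants

variable {n : ℕ} {k L L' : Type u} [Field k] [Field L] [Field L'] [Algebra k L] [Algebra k L']
  {S T : Over (Spec (CommRingCat.of k))} {A B : Type u} [Ring A] [Algebra k A] [Ring B]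
  [Algebra k B]

theorem det_generalLinearGroup_map {m : Type*} [Fintype m] [DecidableEq m] (τ : L →+* L')
    (M : GL m L) : (Matrix.GeneralLinearGroup.map τ M).1.det = τ M.1.det :=
  (RingHom.map_det τ M.1).symm

/-- A matrix over a larger Galois extension which is compatible with a twist defined over `L` has
its entries in `L`. -/
theorem exists_map_eq_of_compatible [FiniteDimensional k L'] [IsGalois k L'] [Normal k L]
    [Algebra L L'] [IsScalarTower k L L'] {p : (projSpace n L).left ⟶ S.left}
    (hp : IsSplitting S p) {a : (L ≃ₐ[k] L) → GL (Fin (n + 1)) L} (ha : IsTwistOf a p)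
    {M : GL (Fin (n + 1)) L'}
    (hM : ∀ g : L' ≃ₐ[k] L', Matrix.GeneralLinearGroup.map (g : L' →+* L') M =
      (Matrix.GeneralLinearGroup.map (algebraMap L L') (a (g.restrictNormal L)))⁻¹ * M *
        Matrix.GeneralLinearGroup.map (algebraMap L L') (a (g.restrictNormal L))) :
    ∃ N : GL (Fin (n + 1)) L, Matrix.GeneralLinearGroup.map (algebraMap L L') N = M ∧
      ∀ g : L ≃ₐ[k] L, Matrix.GeneralLinearGroup.map (g : L →+* L) N = (a g)⁻¹ * N * a g := by
  have : IsGalois L L' := IsGalois.tower_top_of_isGalois k L L'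
  have : FiniteDimensional L L' := FiniteDimensional.right k L L'
  have h1 : projGalois n (1 : L ≃ₐ[k] L) = 𝟙 _ := by
    rw [projGalois_eq_projExt, inv_one]
    exact projExt_id
  -- The identity of the Galois group acts trivially, so `a 1` is scalar. Elements of `Gal(L'/L)`
  -- restrict to the identity on `L`, and compatibility then says that they fix the entries of `M`.
  obtain ⟨c, hc⟩ : ∃ c : L, (a 1).1 = c • 1 := by
    refine exists_smul_one_of_projLinear_eq_id (hp.hom_ext ?_ ?_)
    · have h2 := ha 1
      rw [h1, Category.id_comp] at h2
      rw [h2, Category.id_comp]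
    · rw [projLinear_hom, Category.id_comp]
  have hc' : (Matrix.GeneralLinearGroup.map (algebraMap L L') (a 1)).1 =
      algebraMap L L' c • (1 : GL (Fin (n + 1)) L').1 := by
    change (a 1).1.map (algebraMap L L') = _
    rw [hc]
    ext i j
    by_cases hij : i = j <;> simp [hij]
  have hfix : ∀ i j, ∃ x : L, algebraMap L L' x = M.1 i j := fun i j => by
    refine (IsGalois.mem_bot_iff_fixed (F := L) (M.1 i j)).2 fun g => ?_
    have h2 := hM (g.restrictScalars k)
    have h3 : (g.restrictScalars k).restrictNormal L = 1 := by
      ext x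
      apply (algebraMap L L').injective
      rw [AlgEquiv.restrictNormal_commutes]
      exact g.commutes x
    have h4 : (Matrix.GeneralLinearGroup.map (algebraMap L L') (a 1))⁻¹ * M *
        Matrix.GeneralLinearGroup.map (algebraMap L L') (a 1) = M := by
      have h5 := smul_conj_eq hc' M
      rw [one_mul, inv_one, mul_one, mul_inv_eq_iff_eq_mul] at h5
      rw [mul_assoc, ← h5, inv_mul_cancel_left]
    rw [h3, h4] at h2
    have h6 : (Matrix.GeneralLinearGroup.map (g : L' →+* L') M).1 i j = M.1 i j :=
      congrArg (fun X : GL (Fin (n + 1)) L' => X.1 i j) h2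
    exact h6
  choose N hN using hfix
  have hNM : (Matrix.of N).map (algebraMap L L') = M.1 := Matrix.ext hN
  have hdet : (Matrix.of N).det ≠ 0 := fun h0 => by
    have h2 := RingHom.map_det (algebraMap L L') (Matrix.of N)
    rw [h0, map_zero, RingHom.mapMatrix_apply, hNM] at h2
    exact ((Matrix.isUnit_iff_isUnit_det _).1 M.isUnit).ne_zero h2.symm
  have hmap : Matrix.GeneralLinearGroup.map (algebraMap L L')
      (Matrix.GeneralLinearGroup.mkOfDetNeZero _ hdet) = M := Units.ext hNM
  refine ⟨_, hmap, fun h => ?_⟩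
  obtain ⟨g, rfl⟩ := AlgEquiv.restrictNormalHom_surjective (F := k) (K₁ := L) L' h
  have hinj : Function.Injective (Matrix.GeneralLinearGroup.map (n := Fin (n + 1))
      (algebraMap L L')) := fun X Y hXY => by
    ext i j
    exact (algebraMap L L').injective (congrArg (fun X : GL (Fin (n + 1)) L' => X.1 i j) hXY)
  apply hinj
  rw [map_mul, map_mul, map_inv, hmap]
  refine Eq.trans ?_ (hM g)
  rw [← hmap]
  ext i j
  exact AlgEquiv.restrictNormal_commutes g L _

theorem finrank_eq_of_algEquiv (f : (L ⊗[k] A) ≃ₐ[L] Matrix (Fin 3) (Fin 3) L) :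
    Module.finrank k A = 9 := by
  rw [← Module.finrank_baseChange (R := L), f.toLinearEquiv.finrank_eq, Module.finrank_matrix]
  simp

/-- `HasDet` may use any field and any splitting; this moves the representant to a prescribed one.
Over a compositum it becomes a conjugate, with the same determinant `d`, and the conjugate is
compatible with a twist defined over `L`, so it descends to `L`. -/
theorem exists_compatible_of_hasDet [FiniteDimensional k L] [IsGalois k L]
    {p : (projSpace 2 L).left ⟶ S.left} (hp : IsSplitting S p)
    {a : (L ≃ₐ[k] L) → GL (Fin 3) L} (ha : IsTwistOf a p) {α : Aut S} {c : UnitsModCubes k}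
    (hc : HasDet α c) : ∃ (M : GL (Fin 3) L) (d : kˣ), c = QuotientGroup.mk d ∧
      M.1.det = algebraMap k L d ∧
      ∀ g : L ≃ₐ[k] L, Matrix.GeneralLinearGroup.map (g : L →+* L) M = (a g)⁻¹ * M * a g := by
  obtain ⟨L₀, _, _, _, _, φ, a₀, A₀, d, hφ, ⟨hA, hAg⟩, hd, rfl⟩ := hc
  obtain ⟨E, _, _, _, _, _, _, _, _⟩ := exists_compositum (k := k) (L₀ := L₀) (L₁ := L)
  have hp₀ := (isSplitting_splittingOf φ).comp_projExt (L' := E)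
  have hp₁ := hp.comp_projExt (L' := E)
  have ha₀ := isTwistOf_comp_projExt (L' := E) (isTwistOf_of_isCocycleOf hφ)
    (fun g => g.restrictNormal L₀) fun g x => AlgEquiv.restrictNormal_commutes g L₀ x
  have ha₁ := isTwistOf_comp_projExt (L' := E) ha
    (fun g => g.restrictNormal L) fun g x => AlgEquiv.restrictNormal_commutes g L x
  obtain ⟨N, hN⟩ := hp₀.exists_projLinear_comp_eq hp₁
  have hA₀ : ∀ g : E ≃ₐ[k] E, Matrix.GeneralLinearGroup.map (g : E →+* E)
      (Matrix.GeneralLinearGroup.map (algebraMap L₀ E) A₀) =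
      (Matrix.GeneralLinearGroup.map (algebraMap L₀ E) (a₀ (g.restrictNormal L₀)))⁻¹ *
        Matrix.GeneralLinearGroup.map (algebraMap L₀ E) A₀ *
        Matrix.GeneralLinearGroup.map (algebraMap L₀ E) (a₀ (g.restrictNormal L₀)) := fun g => by
    rw [← map_inv, ← map_mul, ← map_mul, ← hAg]
    ext i j
    exact (AlgEquiv.restrictNormal_commutes g L₀ _).symm
  obtain ⟨M, hM, hMg⟩ := exists_map_eq_of_compatible hp ha
    fun g => conj_map_eq hp₁ ha₀ ha₁ hN (hA₀ g)
  refine ⟨M, d, rfl, ?_, hMg⟩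
  apply (algebraMap L E).injective
  rw [← det_generalLinearGroup_map, hM, Units.val_mul, Units.val_mul, Matrix.det_mul_right_comm,
    ← Units.val_mul, mul_inv_cancel, Units.val_one, one_mul, det_generalLinearGroup_map, hd,
    ← IsScalarTower.algebraMap_apply, ← IsScalarTower.algebraMap_apply]

theorem exists_hasDet_of_compatible [FiniteDimensional k L] [IsGalois k L]
    {φ : (baseChange k L).obj S ≅ projSpace 2 L} {a : (L ≃ₐ[k] L) → GL (Fin 3) L}
    (h : IsCocycleOf φ a) {M : GL (Fin 3) L} {d : kˣ} (hd : M.1.det = algebraMap k L d)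
    (hM : ∀ g : L ≃ₐ[k] L,
      Matrix.GeneralLinearGroup.map (g : L →+* L) M = (a g)⁻¹ * M * a g) :
    ∃ α : Aut S, HasDet α (QuotientGroup.mk d) := by
  obtain ⟨α, hα⟩ := exists_aut (isSplitting_splittingOf φ) (isTwistOf_of_isCocycleOf h) hM
  have hα' : IsAffineRepresentant φ a α M := ⟨left_eq_projLinear_iff.2 hα, hM⟩
  exact ⟨α, L, inferInstance, inferInstance, inferInstance, inferInstance, φ, a, M, d, h, hα', hd,
    rfl⟩

/-- The compatible matrices are those that come from the algebra. -/
theorem exists_eq_of_compatible [FiniteDimensional k L] [IsGalois k L]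
    {a : (L ≃ₐ[k] L) → GL (Fin 3) L} (f : (L ⊗[k] A) ≃ₐ[L] Matrix (Fin 3) (Fin 3) L)
    (hf : ∀ (g : L ≃ₐ[k] L) (x : L ⊗[k] A),
      f (Algebra.TensorProduct.map (g : L →ₐ[k] L) (AlgHom.id k A) x) =
        (a g).1 * (f x).map g * (a g)⁻¹.1)
    {M : GL (Fin 3) L} (hM : ∀ g : L ≃ₐ[k] L,
      Matrix.GeneralLinearGroup.map (g : L →+* L) M = (a g)⁻¹ * M * a g) :
    ∃ x : A, f (1 ⊗ₜ x) = M.1 := by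
  have : FiniteDimensional k A := .of_finrank_pos (by rw [finrank_eq_of_algEquiv f]; norm_num)
  -- Compatibility means `M = a g * M^g * (a g)⁻¹`, and the right-hand side is the image under `f`
  -- of the Galois conjugate of `f.symm M`.
  obtain ⟨x, hx⟩ := exists_eq_one_tmul_of_forall_map_eq (y := f.symm M.1) fun g => by
    apply f.injective
    rw [hf, AlgEquiv.apply_symm_apply]
    have h1 : M.1.map g = ((a g)⁻¹ * M * a g).1 := congrArg Units.val (hM g)
    rw [h1, ← Units.val_mul, ← Units.val_mul]
    congr 1
    group
  exact ⟨x, by rw [← hx, AlgEquiv.apply_symm_apply]⟩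

theorem compatible_of_eq {a : (L ≃ₐ[k] L) → GL (Fin 3) L}
    (f : (L ⊗[k] A) ≃ₐ[L] Matrix (Fin 3) (Fin 3) L)
    (hf : ∀ (g : L ≃ₐ[k] L) (x : L ⊗[k] A),
      f (Algebra.TensorProduct.map (g : L →ₐ[k] L) (AlgHom.id k A) x) =
        (a g).1 * (f x).map g * (a g)⁻¹.1)
    {M : GL (Fin 3) L} {x : A} (hx : f (1 ⊗ₜ x) = M.1) (g : L ≃ₐ[k] L) :
    Matrix.GeneralLinearGroup.map (g : L →+* L) M = (a g)⁻¹ * M * a g := by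
  have h1 := hf g (1 ⊗ₜ x)
  rw [Algebra.TensorProduct.map_tmul, map_one, AlgHom.id_apply, hx] at h1
  have h2 : M = a g * Matrix.GeneralLinearGroup.map (g : L →+* L) M * (a g)⁻¹ := Units.ext h1
  conv_rhs => rw [h2]
  group

/-- Passing to the opposite algebra does not change reduced norms. -/
theorem det_op_eq [FiniteDimensional k L] [IsGalois k L] [FiniteDimensional k L'] [IsGalois k L']
    (f : (L ⊗[k] A) ≃ₐ[L] Matrix (Fin 3) (Fin 3) L)
    (f' : (L' ⊗[k] B) ≃ₐ[L'] Matrix (Fin 3) (Fin 3) L') (e : A ≃ₐ[k] Bᵐᵒᵖ) (x : A) {d : k}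
    (hd : (f (1 ⊗ₜ x)).det = algebraMap k L d) :
    (f' (1 ⊗ₜ (e x).unop)).det = algebraMap k L' d := by
  obtain ⟨E, _, _, _, _, _, _, _, _⟩ := exists_compositum (k := k) (L₀ := L) (L₁ := L')
  have hA : Module.finrank k A = 9 := finrank_eq_of_algEquiv f
  have : FiniteDimensional k A := .of_finrank_pos (by rw [hA]; norm_num)
  let F : A →ₐ[k] Matrix (Fin 3) (Fin 3) E :=
    ((IsScalarTower.toAlgHom k L E).mapMatrix.comp (f.toAlgHom.restrictScalars k)).comp
      Algebra.TensorProduct.includeRight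
  let G₀ : B →ₐ[k] Matrix (Fin 3) (Fin 3) E :=
    ((IsScalarTower.toAlgHom k L' E).mapMatrix.comp (f'.toAlgHom.restrictScalars k)).comp
      Algebra.TensorProduct.includeRight
  -- Transposition turns the representation of `B` into one of its opposite algebra, and so of `A`
  -- through `e`; it does not affect determinants.
  let G : A →ₐ[k] Matrix (Fin 3) (Fin 3) E :=
    ((Matrix.transposeAlgEquiv (Fin 3) k E).symm.toAlgHom.comp (AlgHom.op G₀)).comp e.toAlgHom
  have hG : ∀ y, G y = (G₀ (e y).unop).transpose := fun y => rfl
  have hGr : Set.range G = Matrix.transposeLinearEquiv (Fin 3) (Fin 3) E E '' Set.range G₀ := by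
    ext M
    constructor
    · rintro ⟨y, rfl⟩
      exact ⟨_, ⟨(e y).unop, rfl⟩, rfl⟩
    · rintro ⟨_, ⟨y, rfl⟩, rfl⟩
      exact ⟨e.symm (MulOpposite.op y), by rw [hG, AlgEquiv.apply_symm_apply]; rfl⟩
  have hFs : Submodule.span E (Set.range F) = ⊤ :=
    span_range_map_eq_top (span_range_one_tmul_eq_top f)
  have hG₀s : Submodule.span E (Set.range G₀) = ⊤ :=
    span_range_map_eq_top (span_range_one_tmul_eq_top f')
  have hGs : Submodule.span E (Set.range G) = ⊤ := by
    rw [hGr, ← LinearEquiv.coe_coe, Submodule.span_image, hG₀s, Submodule.map_top,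
      LinearEquiv.range]
  have h := det_eq_of_span_range_eq_top (by rw [hA]; rfl) F G hFs hGs x
  rw [hG, Matrix.det_transpose] at h
  apply (algebraMap L' E).injective
  have h1 : (F x).det = algebraMap L E (f (1 ⊗ₜ x)).det := (RingHom.map_det _ _).symm
  have h2 : (G₀ (e x).unop).det = algebraMap L' E (f' (1 ⊗ₜ (e x).unop)).det :=
    (RingHom.map_det _ _).symm
  rw [← h2, ← h, h1, hd, ← IsScalarTower.algebraMap_apply, ← IsScalarTower.algebraMap_apply]

/-- An automorphism of `S` gives an element `x` of `A`; the same element viewed in `B` has the same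
reduced norm, hence an invertible image, which descends to an automorphism of `T`. Stated for an
isomorphism `e` so that it applies in both directions. -/
theorem detImage_subset_of_corresponds (hS : Corresponds S A) (hT : Corresponds T B)
    (e : A ≃ₐ[k] Bᵐᵒᵖ) : detImage S ⊆ detImage T := by
  rintro c ⟨α, hα⟩
  obtain ⟨L, _, _, _, _, φ, a, f, hφ, hf⟩ := hS
  obtain ⟨L', _, _, _, _, φ', a', f', hφ', hf'⟩ := hT
  obtain ⟨M, d, rfl, hd, hM⟩ := exists_compatible_of_hasDet (isSplitting_splittingOf φ)
    (isTwistOf_of_isCocycleOf hφ) hα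
  obtain ⟨x, hx⟩ := exists_eq_of_compatible f hf hM
  have hdet := det_op_eq f f' e x (d := d) (by rw [hx, hd])
  have hne : (f' (1 ⊗ₜ (e x).unop)).det ≠ 0 := by
    rw [hdet]
    exact (map_ne_zero _).2 d.ne_zero
  exact exists_hasDet_of_compatible hφ' (M := Matrix.GeneralLinearGroup.mkOfDetNeZero _ hne) hdet
    (compatible_of_eq f' hf' rfl)

end Determinants

end SeveriBrauer

end

theorem mainTheorem10 {k : Type u} [Field k] [PerfectField k]
    (S T : Over (AlgebraicGeometry.Spec (CommRingCat.of k)))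
    (hS : SeveriBrauer.IsSeveriBrauerSurface S) (hS' : ¬ SeveriBrauer.IsTrivial S)
    (hT : SeveriBrauer.IsSeveriBrauerSurface T) (hST : SeveriBrauer.IsOpposite S T) :
    SeveriBrauer.detImage S = SeveriBrauer.detImage T := by
  obtain ⟨A, _, _, -, -, -, hA, hA'⟩ := hST
  -- One inclusion uses that `A` is the opposite of `Aᵐᵒᵖ`, the other that `Aᵐᵒᵖ` is the opposite of
  -- `A`.
  exact (SeveriBrauer.detImage_subset_of_corresponds hA hA' (AlgEquiv.opOp k A)).antisymm
    (SeveriBrauer.detImage_subset_of_corresponds hA' hA AlgEquiv.refl)
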